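/- Let $n\in\mathbb N$ and $1\le p<\infty$. For an open set $\Omega\subset\mathbb R^n$ let $L^{1,p}(\Omega)$ be the space of (almost everywhere classes of) locally integrable functions $u$ on $\Omega$ whose weak gradient $\nabla u$ belongs to $L^p(\Omega)$, with the seminorm $\|u\|_{L^{1,p}(\Omega)}=\left(\int_\Omega|\nabla u|^p\,dx\right)^{1/p}$. A (not necessarily linear) map $E\colon L^{1,p}(\Omega)\to L^{1,p}(\mathbb R^n)$ is an extension operator if $Eu=u$ almost everywhere on $\Omega$ for every $u\in L^{1,p}(\Omega)$ and there is a constant $C\ge1$ with $\|Eu\|_{L^{1,p}(\mathbb R^n)}\le C\|u\|_{L^{1,p}(\Omega)}$ for all $u\in L^{1,p}(\Omega)$; the infimum of such constants $C\geq 1$ is denoted $\|E\|$. A domain is a non-empty connected open set, $\mathbf m_n$ is Lebesgue measure, and $B(x,r)$ is the open ball. **Proposition 2.2 (measure density condition).** 1. If $1\le p<n$, there is a constant $C(n,p)>0$, depending only on $n$ and $p$, such that the following holds. Let $\Omega\subset\mathbb R^n$ be a domain with an extension operator $E\colon L^{1,p}(\Omega)\to L^{1,p}(\mathbb R^n)$,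 let $x\in\overline\Omega$, let $$0<r<\min\left\{1,\left(\frac{\mathbf m_n(\Omega)}{2\,\mathbf m_n(B(0,1))}\right)^{1/n}\right\}$$ (where the second term is $\infty$ if $\mathbf m_n(\Omega)=\infty$), and let $\Omega'$ be a connected component of $\Omega\cap B(x,r)$ with $x\in\overline{\Omega'}$. Then $\mathbf m_n(\Omega')\ge C(n,p)\,\|E\|^{-n}\,r^n$. 2. If $p>n-1$, there is a constant $C(n,p)>0$, depending only on $n$ and $p$, such that the following holds. Let $\Omega\subset\mathbb R^n$ be a domain with an extension operator $E\colon L^{1,p}(\Omega)\to L^{1,p}(\mathbb R^n)$, let $x\in\overline\Omega$, let $0<r<\operatorname{diam}(\Omega)\in[0,\infty]$, and let $\Omega'$ be a connected component of $\Omega\cap B(x,r)$ with $x\in\overline{\Omega'}$. Then $\mathbf m_n(\Omega')\ge C(n,p)\,\|E\|^{-p}\,r^n$. -/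

import Mathlib

open MeasureTheory Set
open scoped ENNReal ContDiff

/-- `g` is a weak gradient of `u` on the open set `Ω ⊆ ℝⁿ`: both are locally integrable on `Ω`, and
`∫_Ω u ∂ᵢφ = - ∫_Ω gᵢ φ` for every `i` and every test function `φ ∈ C_c^∞(Ω)`. -/
def IsWeakGradientOn {n : ℕ} (Ω : Set (EuclideanSpace ℝ (Fin n)))
    (u : EuclideanSpace ℝ (Fin n) → ℝ)
    (g : EuclideanSpace ℝ (Fin n) → EuclideanSpace ℝ (Fin n)) : Prop :=
  LocallyIntegrableOn u Ω volume ∧ LocallyIntegrableOn g Ω volume ∧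
    ∀ φ : EuclideanSpace ℝ (Fin n) → ℝ, ContDiff ℝ ∞ φ → HasCompactSupport φ → tsupport φ ⊆ Ω →
      ∀ i : Fin n,
        ∫ x in Ω, u x * fderiv ℝ φ x (EuclideanSpace.single i 1) = - ∫ x in Ω, g x i * φ x

/-- The homogeneous Sobolev space `L^{1,p}(Ω)`: the (almost everywhere classes of) locally
integrable functions on `Ω` that have a weak gradient in `L^p(Ω)`. -/
def HomSobolev {n : ℕ} (Ω : Set (EuclideanSpace ℝ (Fin n))) (p : ℝ) :
    Set (EuclideanSpace ℝ (Fin n) →ₘ[volume.restrict Ω] ℝ) :=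
  {u | ∃ g : EuclideanSpace ℝ (Fin n) → EuclideanSpace ℝ (Fin n),
    IsWeakGradientOn Ω u g ∧ MemLp g (ENNReal.ofReal p) (volume.restrict Ω)}

/-- The weak gradient `∇u` of `u ∈ L^{1,p}(Ω)` (it is unique up to almost everywhere equality on
`Ω`). -/
noncomputable def HomSobolev.weakGrad {n : ℕ} {Ω : Set (EuclideanSpace ℝ (Fin n))} {p : ℝ}
    (u : HomSobolev Ω p) : EuclideanSpace ℝ (Fin n) → EuclideanSpace ℝ (Fin n) :=
  u.2.choose

/-- The homogeneous seminorm `‖u‖_{L^{1,p}(Ω)} = (∫_Ω |∇u|^p)^{1/p}`. -/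
noncomputable def HomSobolev.seminorm {n : ℕ} {Ω : Set (EuclideanSpace ℝ (Fin n))} {p : ℝ}
    (u : HomSobolev Ω p) : ℝ :=
  (∫ x in Ω, ‖HomSobolev.weakGrad u x‖ ^ p) ^ (1 / p)

/-- The constants `C ≥ 1` with `‖Eu‖_{L^{1,p}(ℝⁿ)} ≤ C ‖u‖_{L^{1,p}(Ω)}` for all
`u ∈ L^{1,p}(Ω)`. -/
def extensionConstants {n : ℕ} {Ω : Set (EuclideanSpace ℝ (Fin n))} {p : ℝ}
    (E : HomSobolev Ω p → HomSobolev (univ : Set (EuclideanSpace ℝ (Fin n))) p) : Set ℝ :=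
  {C | 1 ≤ C ∧ ∀ u : HomSobolev Ω p, HomSobolev.seminorm (E u) ≤ C * HomSobolev.seminorm u}

/-- `E : L^{1,p}(Ω) → L^{1,p}(ℝⁿ)` is an extension operator (not necessarily linear): `Eu = u`
almost everywhere on `Ω`, and `E` is bounded for the homogeneous seminorms. -/
def IsExtensionOperator {n : ℕ} {Ω : Set (EuclideanSpace ℝ (Fin n))} {p : ℝ}
    (E : HomSobolev Ω p → HomSobolev (univ : Set (EuclideanSpace ℝ (Fin n))) p) : Prop :=
  (∀ u : HomSobolev Ω p, (E u).1 =ᵐ[volume.restrict Ω] u.1) ∧ (extensionConstants E).Nonempty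

/-- The norm `‖E‖` of an extension operator, the infimum of the admissible constants. -/
noncomputable def extensionNorm {n : ℕ} {Ω : Set (EuclideanSpace ℝ (Fin n))} {p : ℝ}
    (E : HomSobolev Ω p → HomSobolev (univ : Set (EuclideanSpace ℝ (Fin n))) p) : ℝ :=
  sInf (extensionConstants E)

/-- `A` is a connected component of the set `S`. -/
def IsConnectedComponentOf {X : Type*} [TopologicalSpace X] (A S : Set X) : Prop :=
  ∃ y ∈ S, A = connectedComponentIn S y

/-! Write m(t) for the volume of Ω' ∩ B(x,t). Apply `E` to the function on Ω that equals 1 on Ω' ∩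
B(x,s), vanishes off Ω' ∩ B(x,t) and has slope at most L/(t-s). Its extension v has energy ∫|∇v|^p
at most (‖E‖ L/(t-s))^p m(t) (`exists_extension_cutoff`). Capacity estimates in ℝⁿ restrict how
cheaply v can be 1 on D = Ω' ∩ B(x,s) and 0 on another part A of Ω.

For p < n, energy at most η ρ^(n-p) forces A or D to have volume at most C ρ^n
(`exists_volume_le_of_integral_le`). With A = Ω minus the closed ball of radius r, too large by the
restriction on r, this gives m(s) ≤ m(t)/2 as soon as t-s is at least a constant times ‖E‖
m(t)^(1/n). As m > 0 at every positive radius, such halvings cannot exhaust the radius, which bounds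
r by ‖E‖ m(r/2)^(1/n) up to a constant (`le_of_halving`).

For p > n-1 a single cutoff suffices. Ω' is connected, accumulates at x and leaves B(x,r/2), so
inner and outer parts of Ω' both meet spheres about x for a set of radii of length at least r/8, and
this costs energy of order r^(n-p) (`exists_mul_pow_le_integral`).

Both capacity estimates follow averages of v through dyadic scales. The averages stay close to the
value of v at a point unless energy concentrates near it (`abs_sub_bumpAvg_le`), and a Vitali
covering bounds the set of exceptional points, in volume or in radial projection. -/

/-! ### Covering estimate -/

/-- A Vitali-type covering estimate: if every point of `D` is the centre of a ball of bounded radius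
`s` whose `ν`-mass is at least `l * s ^ k`, and the outer measure `τ` of balls of radius `s` is at
most `K * s ^ k`, then `l * τ D ≤ K * 5 ^ k * ν univ`. -/
theorem MeasureTheory.OuterMeasure.mul_le_of_closedBall {X : Type*} [MetricSpace X]
    [TopologicalSpace.SeparableSpace X] [MeasurableSpace X] [OpensMeasurableSpace X]
    (τ : OuterMeasure X) (ν : Measure X) (K l : ℝ≥0∞) (k : ℕ) (ρ : ℝ)
    (hτ : ∀ y s, 0 < s → τ (Metric.closedBall y s) ≤ K * ENNReal.ofReal s ^ k) (D : Set X)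
    (hD : ∀ y ∈ D, ∃ s, 0 < s ∧ s ≤ ρ ∧ l * ENNReal.ofReal s ^ k ≤ ν (Metric.closedBall y s)) :
    l * τ D ≤ K * 5 ^ k * ν univ := by
  choose! s hs0 hsρ hsν using hD
  obtain ⟨u, huD, hdisj, hcov⟩ := Vitali.exists_disjoint_subfamily_covering_enlargement_closedBall
    D (fun y => y) s ρ hsρ 5 (by norm_num)
  have hcount : u.Countable := hdisj.countable_of_nonempty_interior fun i hi =>
    ⟨i, Metric.ball_subset_interior_closedBall (Metric.mem_ball_self (hs0 i (huD hi)))⟩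
  have hsub : D ⊆ ⋃ b ∈ u, Metric.closedBall b (5 * s b) := by
    intro y hy
    obtain ⟨b, hb, hyb⟩ := hcov y hy
    exact mem_biUnion hb (hyb (Metric.mem_closedBall_self (hs0 y hy).le))
  have : Countable u := hcount
  calc l * τ D ≤ l * ∑' b : u, τ (Metric.closedBall (b : X) (5 * s b)) := by
        gcongr
        refine (measure_mono hsub).trans ?_
        rw [biUnion_eq_iUnion]
        exact measure_iUnion_le _
    _ ≤ l * ∑' b : u, K * 5 ^ k * ENNReal.ofReal (s b) ^ k := by
        gcongr with b
        refine (hτ _ _ (mul_pos (by norm_num) (hs0 b (huD b.2)))).trans_eq ?_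
        rw [ENNReal.ofReal_mul (by norm_num), mul_pow, mul_assoc]
        norm_num
    _ = K * 5 ^ k * ∑' b : u, l * ENNReal.ofReal (s b) ^ k := by
        rw [ENNReal.tsum_mul_left, ENNReal.tsum_mul_left]; ring
    _ ≤ K * 5 ^ k * ∑' b : u, ν (Metric.closedBall (b : X) (s b)) := by
        gcongr with b
        exact hsν b (huD b.2)
    _ ≤ K * 5 ^ k * ν univ := by
        gcongr
        rw [← measure_iUnion]
        · exact measure_mono (subset_univ _)
        · intro i j hij
          exact hdisj i.2 j.2 (fun h => hij (Subtype.ext h))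
        · exact fun _ => Metric.isClosed_closedBall.measurableSet

/-! ### Smooth averages -/

/-- A smooth bump function on `ℝⁿ` supported in the unit ball, with integral one. -/
noncomputable def unitBump (n : ℕ) : EuclideanSpace ℝ (Fin n) → ℝ :=
  (⟨1 / 2, 1, by norm_num, by norm_num⟩ : ContDiffBump (0 : EuclideanSpace ℝ (Fin n))).normed volume

section UnitBump

variable {n : ℕ}

theorem contDiff_unitBump : ContDiff ℝ ∞ (unitBump n) := ContDiffBump.contDiff_normed _

theorem hasCompactSupport_unitBump : HasCompactSupport (unitBump n) :=
  ContDiffBump.hasCompactSupport_normed _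

theorem integral_unitBump : ∫ x, unitBump n x = 1 := ContDiffBump.integral_normed _

theorem unitBump_eq_zero {x : EuclideanSpace ℝ (Fin n)} (hx : 1 ≤ ‖x‖) : unitBump n x = 0 := by
  by_contra h
  have h2 : x ∈ Function.support (unitBump n) := h
  rw [unitBump, ContDiffBump.support_normed_eq] at h2
  simp at h2
  linarith

theorem fderiv_unitBump_eq_zero {x : EuclideanSpace ℝ (Fin n)} (hx : 1 < ‖x‖) :
    fderiv ℝ (unitBump n) x = 0 := by
  have h : unitBump n =ᶠ[nhds x] fun _ => 0 := by
    filter_upwards [(isOpen_lt continuous_const continuous_norm).mem_nhds hx] with y hy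
    exact unitBump_eq_zero (le_of_lt hy)
  rw [h.fderiv_eq]; simp

/-- The average of `v` around `y` at scale `s`. -/
noncomputable def bumpAvg (v : EuclideanSpace ℝ (Fin n) → ℝ) (y : EuclideanSpace ℝ (Fin n))
    (s : ℝ) : ℝ :=
  ∫ z, v z * ((s ^ n)⁻¹ * unitBump n (s⁻¹ • (z - y)))

theorem bumpAvg_const (c : ℝ) (y : EuclideanSpace ℝ (Fin n)) {s : ℝ} (hs : 0 < s) :
    bumpAvg (fun _ => c) y s = c := by
  rw [bumpAvg, integral_const_mul, integral_const_mul,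
    integral_sub_right_eq_self (fun z => unitBump n (s⁻¹ • z)) y,
    Measure.integral_comp_smul, integral_unitBump]
  simp [abs_of_pos hs]
  field_simp

theorem bumpAvg_eq_of_ae_eq {v : EuclideanSpace ℝ (Fin n) → ℝ} {c : ℝ}
    {y : EuclideanSpace ℝ (Fin n)} {s : ℝ} (hs : 0 < s)
    (hv : ∀ᵐ z, z ∈ Metric.ball y s → v z = c) : bumpAvg v y s = c := by
  rw [← bumpAvg_const c y hs]
  refine integral_congr_ae ?_
  filter_upwards [hv] with z hz
  by_cases h : z ∈ Metric.ball y s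
  · simp [hz h]
  · have : unitBump n (s⁻¹ • (z - y)) = 0 := by
      apply unitBump_eq_zero
      rw [Metric.mem_ball, dist_eq_norm, not_lt] at h
      rw [norm_smul, norm_inv, Real.norm_eq_abs, abs_of_pos hs, inv_mul_eq_div, le_div_iff₀ hs]
      linarith
    simp [this]

/-- Sum of the scalar identities tested on the components of `Θ`. -/
theorem IsWeakGradientOn.integral_div {v : EuclideanSpace ℝ (Fin n) → ℝ}
    {g : EuclideanSpace ℝ (Fin n) → EuclideanSpace ℝ (Fin n)} (h : IsWeakGradientOn univ v g)
    {Θ : EuclideanSpace ℝ (Fin n) → EuclideanSpace ℝ (Fin n)} (hΘ : ContDiff ℝ ∞ Θ)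
    (hc : HasCompactSupport Θ) :
    ∫ x, v x * ∑ i, fderiv ℝ Θ x (EuclideanSpace.single i 1) i = - ∫ x, inner ℝ (g x) (Θ x) := by
  obtain ⟨hv, hg, hvg⟩ := h
  rw [locallyIntegrableOn_univ] at hv hg
  have hcomp : ∀ i, ContDiff ℝ ∞ (fun x => Θ x i) := fun i =>
    (EuclideanSpace.proj (𝕜 := ℝ) i).contDiff.comp hΘ
  have hcs : ∀ i, HasCompactSupport (fun x => Θ x i) := fun i =>
    hc.comp_left (g := fun w : EuclideanSpace ℝ (Fin n) => w i) rfl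
  have hfd : ∀ i x w, fderiv ℝ (fun x => Θ x i) x w = fderiv ℝ Θ x w i := fun i x w => by
    have := ((EuclideanSpace.proj i : EuclideanSpace ℝ (Fin n) →L[ℝ] ℝ).hasFDerivAt.comp x
      (hΘ.differentiable (by simp) x).hasFDerivAt).fderiv
    exact congrArg (fun L => L w) this
  have hgi : ∀ i, LocallyIntegrable (fun x => g x i) := fun i x => by
    obtain ⟨U, hU, hgU⟩ := hg x
    exact ⟨U, hU, (EuclideanSpace.proj (𝕜 := ℝ) i).integrable_comp hgU⟩
  have hI1 : ∀ i, Integrable (fun x => v x * fderiv ℝ Θ x (EuclideanSpace.single i 1) i) := by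
    intro i
    refine hv.integrable_smul_right_of_hasCompactSupport (g := fun x => fderiv ℝ Θ x (EuclideanSpace.single i 1) i) ?_ ?_
    · simp_rw [← hfd]
      exact ((hcomp i).continuous_fderiv (by simp)).clm_apply continuous_const
    · simp_rw [← hfd]
      exact (hcs i).fderiv_apply ℝ _
  have hI2 : ∀ i, Integrable (fun x => g x i * Θ x i) := fun i =>
    (hgi i).integrable_smul_right_of_hasCompactSupport (g := fun x => Θ x i) (hcomp i).continuous (hcs i)
  simp_rw [Finset.mul_sum, PiLp.inner_apply]
  rw [integral_finsetSum _ fun i _ => hI1 i, integral_finsetSum, ← Finset.sum_neg_distrib]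
  · refine Finset.sum_congr rfl fun i _ => ?_
    have := hvg _ (hcomp i) (hcs i) (subset_univ _) i
    simp_rw [hfd, setIntegral_univ] at this
    rw [this]
    simp [mul_comm]
  · intro i _
    simpa [mul_comm] using hI2 i

end UnitBump

/-! ### Derivative of the averages in centre and scale -/

section BumpAvgDeriv

variable {n : ℕ}

/-- The divergence of `x ↦ unitBump n x • (a + c • x)`. -/
noncomputable def unitBumpDiv (a : EuclideanSpace ℝ (Fin n)) (c : ℝ)
    (x : EuclideanSpace ℝ (Fin n)) : ℝ :=
  fderiv ℝ (unitBump n) x (a + c • x) + n * c * unitBump n x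

theorem continuous_unitBumpDiv (a : EuclideanSpace ℝ (Fin n)) (c : ℝ) :
    Continuous (unitBumpDiv a c) :=
  ((contDiff_unitBump.continuous_fderiv (by simp)).clm_apply (by fun_prop)).add
    (continuous_const.mul contDiff_unitBump.continuous)

theorem unitBumpDiv_eq_zero (a : EuclideanSpace ℝ (Fin n)) (c : ℝ) {x : EuclideanSpace ℝ (Fin n)}
    (hx : 1 < ‖x‖) : unitBumpDiv a c x = 0 := by
  simp [unitBumpDiv, unitBump_eq_zero hx.le, fderiv_unitBump_eq_zero hx]

theorem exists_bound_unitBumpDiv (a : EuclideanSpace ℝ (Fin n)) (c : ℝ) :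
    ∃ M, 0 ≤ M ∧ ∀ x, ‖unitBumpDiv a c x‖ ≤ M := by
  obtain ⟨M, hM⟩ := (HasCompactSupport.of_support_subset_isCompact
    (isCompact_closedBall (0 : EuclideanSpace ℝ (Fin n)) 1) (f := unitBumpDiv a c) (by
      intro x hx
      by_contra h
      exact hx (unitBumpDiv_eq_zero a c (by simpa using h)))).exists_bound_of_continuous
    (continuous_unitBumpDiv a c)
  exact ⟨M, (norm_nonneg _).trans (hM 0), hM⟩

/-- Continuity equation: moving the centre y with velocity `a` and the scale s with velocity `c`
transports the kernel's mass along the field a + c(z-y)/s, so the time derivative is minus a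
divergence in `z`. -/
theorem hasDerivAt_bump_kernel (x a z : EuclideanSpace ℝ (Fin n)) (s₀ c t : ℝ)
    (hs : 0 < s₀ + t * c) :
    HasDerivAt (fun t : ℝ => ((s₀ + t * c) ^ n)⁻¹ *
        unitBump n ((s₀ + t * c)⁻¹ • (z - (x + t • a))))
      (-(((s₀ + t * c) ^ (n + 1))⁻¹ *
        unitBumpDiv a c ((s₀ + t * c)⁻¹ • (z - (x + t • a))))) t := by
  have h1 : HasDerivAt (fun t : ℝ => s₀ + t * c) c t := by
    simpa using ((hasDerivAt_id t).mul_const c).const_add s₀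
  have h2 : HasDerivAt (fun t : ℝ => z - (x + t • a)) (-a) t := by
    simpa using (((hasDerivAt_id t).smul_const a).const_add x).const_sub z
  have h3 := (h1.inv hs.ne').smul h2
  have h4 := ((contDiff_unitBump (n := n)).differentiable (by simp)
    ((s₀ + t * c)⁻¹ • (z - (x + t • a)))).hasFDerivAt.comp_hasDerivAt t h3
  have h5 := ((h1.pow n).inv (pow_ne_zero n hs.ne')).mul h4
  refine h5.congr_deriv ?_
  set s := s₀ + t * c with hsdef
  set w := z - (x + t • a)
  change -(n * s ^ (n - 1) * c) / (s ^ n) ^ 2 * unitBump n (s⁻¹ • w) + (s ^ n)⁻¹ *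
    fderiv ℝ (unitBump n) (s⁻¹ • w) (s⁻¹ • -a + (-c / s ^ 2) • w) = _
  clear_value s w
  simp only [unitBumpDiv, map_add, map_smul, map_neg, smul_eq_mul]
  rcases n with _ | m
  · simp; field_simp; ring
  · simp only [Nat.add_sub_cancel]
    field_simp
    push_cast
    ring

theorem contDiff_bump_kernel (y : EuclideanSpace ℝ (Fin n)) (s : ℝ) :
    ContDiff ℝ ∞ (fun z => (s ^ n)⁻¹ * unitBump n (s⁻¹ • (z - y))) :=
  contDiff_const.mul (contDiff_unitBump.comp (by fun_prop))

theorem bump_kernel_eq_zero {y z : EuclideanSpace ℝ (Fin n)} {s : ℝ} (hs : 0 < s)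
    (h : z ∉ Metric.closedBall y s) : 1 < ‖s⁻¹ • (z - y)‖ := by
  rw [Metric.mem_closedBall, dist_eq_norm, not_le] at h
  rwa [norm_smul, norm_inv, Real.norm_eq_abs, abs_of_pos hs, inv_mul_eq_div, one_lt_div hs]

theorem hasCompactSupport_bump_kernel (y : EuclideanSpace ℝ (Fin n)) {s : ℝ} (hs : 0 < s) :
    HasCompactSupport (fun z => (s ^ n)⁻¹ * unitBump n (s⁻¹ • (z - y))) :=
  HasCompactSupport.of_support_subset_isCompact (isCompact_closedBall y s) (by
    intro z hz
    by_contra h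
    exact hz (by simp [unitBump_eq_zero (bump_kernel_eq_zero hs h).le]))

theorem integral_mul_unitBumpDiv {v : EuclideanSpace ℝ (Fin n) → ℝ}
    {g : EuclideanSpace ℝ (Fin n) → EuclideanSpace ℝ (Fin n)} (h : IsWeakGradientOn univ v g)
    (y a : EuclideanSpace ℝ (Fin n)) (c : ℝ) {s : ℝ} (hs : 0 < s) :
    ∫ z, v z * ((s ^ (n + 1))⁻¹ * unitBumpDiv a c (s⁻¹ • (z - y))) =
      - ∫ z, inner ℝ (g z) (a + c • s⁻¹ • (z - y)) * ((s ^ n)⁻¹ * unitBump n (s⁻¹ • (z - y))) := by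
  have hΘ : ContDiff ℝ ∞ (fun z : EuclideanSpace ℝ (Fin n) =>
      ((s ^ n)⁻¹ * unitBump n (s⁻¹ • (z - y))) • (a + c • s⁻¹ • (z - y))) :=
    (contDiff_bump_kernel y s).smul (by fun_prop)
  have hc : HasCompactSupport (fun z : EuclideanSpace ℝ (Fin n) =>
      ((s ^ n)⁻¹ * unitBump n (s⁻¹ • (z - y))) • (a + c • s⁻¹ • (z - y))) :=
    (hasCompactSupport_bump_kernel y hs).smul_right
  have := h.integral_div hΘ hc
  simp_rw [inner_smul_right] at this
  refine Eq.trans (integral_congr_ae (ae_of_all _ fun z => ?_)) (this.trans ?_)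
  · show v z * _ = v z * _
    congr 1
    have hl : HasFDerivAt (fun z : EuclideanSpace ℝ (Fin n) => s⁻¹ • (z - y))
        (s⁻¹ • ContinuousLinearMap.id ℝ _) z :=
      ((hasFDerivAt_id z).sub_const y).const_smul s⁻¹
    have hη := (((contDiff_unitBump (n := n)).differentiable (by simp)
      (s⁻¹ • (z - y))).hasFDerivAt.comp z hl).const_mul ((s ^ n)⁻¹)
    have hV : HasFDerivAt (fun z : EuclideanSpace ℝ (Fin n) => a + c • s⁻¹ • (z - y))
        (c • s⁻¹ • ContinuousLinearMap.id ℝ _) z := (hl.const_smul c).const_add a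
    have hT := (hη.smul hV).fderiv
    simp only [Function.comp_apply] at hT
    have hT' : fderiv ℝ (fun z : EuclideanSpace ℝ (Fin n) =>
      ((s ^ n)⁻¹ * unitBump n (s⁻¹ • (z - y))) • (a + c • s⁻¹ • (z - y))) z = _ := hT
    rw [hT']
    set ξ := s⁻¹ • (z - y)
    have hexp : ∑ i, (a + c • ξ) i • EuclideanSpace.single i (1 : ℝ) = a + c • ξ := by
      have := (EuclideanSpace.basisFun (Fin n) ℝ).sum_repr (a + c • ξ)
      simpa using this
    have hD : ∑ i, fderiv ℝ (unitBump n) ξ (EuclideanSpace.single i (1 : ℝ)) * (a + c • ξ) i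
        = fderiv ℝ (unitBump n) ξ (a + c • ξ) := by
      conv_rhs => rw [← hexp, map_sum]
      refine Finset.sum_congr rfl fun i _ => ?_
      rw [map_smul, smul_eq_mul, mul_comm]
    rw [unitBumpDiv, ← hD]
    simp [Finset.sum_add_distrib, mul_add]
    simp only [mul_assoc, ← Finset.mul_sum]
    rw [pow_succ, mul_inv]
    ring
  · simp [mul_comm]

/-- Differentiation under the integral produces a divergence, which integration by parts trades for
`g`. This is what bounds differences of averages by integrals of ‖g‖. -/
theorem hasDerivAt_bumpAvg {v : EuclideanSpace ℝ (Fin n) → ℝ}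
    {g : EuclideanSpace ℝ (Fin n) → EuclideanSpace ℝ (Fin n)} (h : IsWeakGradientOn univ v g)
    (x a : EuclideanSpace ℝ (Fin n)) (s₀ c t : ℝ) (hs : 0 < s₀ + t * c) :
    HasDerivAt (fun t : ℝ => bumpAvg v (x + t • a) (s₀ + t * c))
      (∫ z, inner ℝ (g z) (a + c • (s₀ + t * c)⁻¹ • (z - (x + t • a))) *
        (((s₀ + t * c) ^ n)⁻¹ * unitBump n ((s₀ + t * c)⁻¹ • (z - (x + t • a))))) t := by
  have hv := h.1
  rw [locallyIntegrableOn_univ] at hv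
  obtain ⟨M, hM0, hM⟩ := exists_bound_unitBumpDiv a c
  -- Half the scale at time `t`: a lower bound for nearby scales, which bounds the kernel's
  -- derivative. All kernels with |τ - t| < 1 are supported in the ball of radius `R` below.
  set σ := (s₀ + t * c) / 2 with hσ
  have hσ0 : 0 < σ := by positivity
  set R := (|t| + 1) * ‖a‖ + (|s₀| + (|t| + 1) * |c|) with hR
  have hnhds : {τ : ℝ | σ < s₀ + τ * c} ∩ Metric.ball t 1 ∈ nhds t := by
    refine Filter.inter_mem ?_ (Metric.ball_mem_nhds t one_pos)
    exact (isOpen_lt continuous_const (by fun_prop)).mem_nhds (by simp [hσ]; linarith)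
  have hKint : IntegrableOn v (Metric.closedBall x R) :=
    hv.integrableOn_isCompact (isCompact_closedBall x R)
  have key := hasDerivAt_integral_of_dominated_loc_of_deriv_le
    (F := fun (t : ℝ) z => v z * (((s₀ + t * c) ^ n)⁻¹ *
        unitBump n ((s₀ + t * c)⁻¹ • (z - (x + t • a)))))
    (F' := fun t z => v z * (-(((s₀ + t * c) ^ (n + 1))⁻¹ *
        unitBumpDiv a c ((s₀ + t * c)⁻¹ • (z - (x + t • a))))))
    (bound := (Metric.closedBall x R).indicator fun z => ‖v z‖ * ((σ ^ (n + 1))⁻¹ * M))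
    (μ := volume) (x₀ := t) hnhds ?_ ?_ ?_ ?_ ?_ ?_
  · refine key.2.congr_deriv ?_
    simp_rw [mul_neg]
    rw [integral_neg, integral_mul_unitBumpDiv h _ _ _ hs, neg_neg]
  · refine Filter.Eventually.of_forall fun τ => ?_
    exact hv.aestronglyMeasurable.mul (contDiff_bump_kernel _ _).continuous.aestronglyMeasurable
  · exact hv.integrable_smul_right_of_hasCompactSupport (contDiff_bump_kernel _ _).continuous
      (hasCompactSupport_bump_kernel _ hs)
  · refine hv.aestronglyMeasurable.mul (Continuous.aestronglyMeasurable ?_)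
    exact (continuous_const.mul ((continuous_unitBumpDiv a c).comp (by fun_prop))).neg
  · refine ae_of_all _ fun z τ hτ => ?_
    obtain ⟨hτ1, hτ2⟩ := hτ
    simp only [mem_ofPred_eq] at hτ1
    have hτ0 : 0 < s₀ + τ * c := hσ0.trans hτ1
    by_cases hz : z ∈ Metric.closedBall x R
    · rw [indicator_of_mem hz, norm_mul, norm_neg, norm_mul]
      gcongr
      · rw [norm_inv, norm_pow, Real.norm_eq_abs, abs_of_pos hτ0]
        gcongr
      · exact hM _
    · rw [indicator_of_notMem hz]
      have : unitBumpDiv a c ((s₀ + τ * c)⁻¹ • (z - (x + τ • a))) = 0 := by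
        apply unitBumpDiv_eq_zero
        apply bump_kernel_eq_zero hτ0
        intro hz2
        apply hz
        rw [Metric.mem_closedBall] at hz2 ⊢
        have ht : |τ| ≤ |t| + 1 := by
          rw [Metric.mem_ball, Real.dist_eq] at hτ2
          have := abs_sub_abs_le_abs_sub τ t
          linarith
        calc dist z x ≤ dist z (x + τ • a) + dist (x + τ • a) x := dist_triangle _ _ _
          _ ≤ (|s₀| + (|t| + 1) * |c|) + (|t| + 1) * ‖a‖ := by
            gcongr
            · refine hz2.trans ((le_abs_self _).trans ((abs_add_le _ _).trans ?_))
              rw [abs_mul]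
              gcongr
            · rw [dist_eq_norm, add_sub_cancel_left, norm_smul, Real.norm_eq_abs]
              gcongr
          _ = R := by rw [hR]; ring
      rw [this]; simp
  · exact (integrable_indicator_iff Metric.isClosed_closedBall.measurableSet).2 (hKint.norm.mul_const _)
  · refine ae_of_all _ fun z τ hτ => ?_
    exact (hasDerivAt_bump_kernel x a z s₀ c τ (hσ0.trans hτ.1)).const_mul (v z)

end BumpAvgDeriv

theorem abs_sub_le_of_geometric {f : ℕ → ℝ} {B q : ℝ} (hB : 0 ≤ B) (hq0 : 0 ≤ q) (hq1 : q < 1)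
    (h : ∀ j, |f (j + 1) - f j| ≤ B * q ^ j) (N : ℕ) : |f N - f 0| ≤ B / (1 - q) := by
  have h1 : dist (f 0) (f N) ≤ ∑ i ∈ Finset.range N, B * q ^ i :=
    dist_le_range_sum_of_dist_le N fun {k} _ => by
      rw [dist_comm, Real.dist_eq]; exact h k
  rw [← Finset.mul_sum, dist_comm, Real.dist_eq] at h1
  refine h1.trans ?_
  rw [div_eq_mul_inv, ← tsum_geometric_of_lt_one hq0 hq1]
  gcongr
  exact (summable_geometric_of_lt_one hq0 hq1).sum_le_tsum _ fun i _ => by positivity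

/-! ### Comparing averages across scales -/

section Telescoping

variable {n : ℕ}

/-- The mean value inequality along a path that halves the scale while moving the centre from x to
y. As dist y x ≤ r/2, every ball on the path stays inside `closedBall x r`. -/
theorem exists_abs_bumpAvg_sub_le (n : ℕ) : ∃ C : ℝ, 0 < C ∧
    ∀ (v : EuclideanSpace ℝ (Fin n) → ℝ) (g : EuclideanSpace ℝ (Fin n) → EuclideanSpace ℝ (Fin n)),
    IsWeakGradientOn univ v g → ∀ (x y : EuclideanSpace ℝ (Fin n)) (r : ℝ), 0 < r →
    dist y x ≤ r / 2 → |bumpAvg v y (r / 2) - bumpAvg v x r| ≤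
      C * (r / r ^ n) * ∫ z in Metric.closedBall x r, ‖g z‖ := by
  obtain ⟨M, hM⟩ := (hasCompactSupport_unitBump (n := n)).exists_bound_of_continuous
    contDiff_unitBump.continuous
  have hM0 : 0 ≤ M := (norm_nonneg _).trans (hM 0)
  -- The scales on the path are at least r/2, whence 2^n; `M + 1` keeps the constant positive.
  refine ⟨2 ^ n * (M + 1), by positivity, fun v g h x y r hr hxy => ?_⟩
  have hg := h.2.1
  rw [locallyIntegrableOn_univ] at hg
  have hgi : IntegrableOn g (Metric.closedBall x r) :=
    hg.integrableOn_isCompact (isCompact_closedBall x r)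
  have hpos : ∀ t ∈ Icc (0 : ℝ) 1, r / 2 ≤ r + t * (-(r / 2)) := fun t ht => by
    nlinarith [ht.2]
  have key := norm_image_sub_le_of_norm_deriv_le_segment_01'
    (f := fun t : ℝ => bumpAvg v (x + t • (y - x)) (r + t * (-(r / 2))))
    (C := 2 ^ n * (M + 1) * (r / r ^ n) * ∫ z in Metric.closedBall x r, ‖g z‖)
    (fun t ht => (hasDerivAt_bumpAvg h x (y - x) r (-(r / 2)) t
      ((half_pos hr).trans_le (hpos t ht))).hasDerivWithinAt) ?_
  · have e1 : x + (1 : ℝ) • (y - x) = y := by rw [one_smul]; abel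
    have e2 : r + -(r / 2) = r / 2 := by ring
    simpa [e1, e2] using key
  · intro t ht
    have ht' : t ∈ Icc (0 : ℝ) 1 := ⟨ht.1, ht.2.le⟩
    have hsr := hpos t ht'
    set s := r + t * (-(r / 2)) with hs
    have hs0 : 0 < s := (half_pos hr).trans_le hsr
    rw [mul_comm, ← integral_mul_const, ← integral_indicator Metric.isClosed_closedBall.measurableSet]
    refine norm_integral_le_of_norm_le ((integrable_indicator_iff
      Metric.isClosed_closedBall.measurableSet).2 (hgi.norm.mul_const _)) (ae_of_all _ fun z => ?_)
    by_cases hz : z ∈ Metric.closedBall (x + t • (y - x)) s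
    · have hz' : z ∈ Metric.closedBall x r := by
        rw [Metric.mem_closedBall] at hz ⊢
        calc dist z x ≤ dist z (x + t • (y - x)) + dist (x + t • (y - x)) x := dist_triangle _ _ _
          _ ≤ s + t * (r / 2) := by
            gcongr
            rw [dist_eq_norm, add_sub_cancel_left, norm_smul, Real.norm_eq_abs,
              abs_of_nonneg ht.1, ← dist_eq_norm]
            exact mul_le_mul_of_nonneg_left hxy ht.1
          _ = r := by rw [hs]; ring
      rw [indicator_of_mem hz', norm_mul]
      have hξ : ‖s⁻¹ • (z - (x + t • (y - x)))‖ ≤ 1 := by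
        rw [Metric.mem_closedBall, dist_eq_norm] at hz
        rwa [norm_smul, norm_inv, Real.norm_eq_abs, abs_of_pos hs0, inv_mul_eq_div, div_le_one hs0]
      have hV : ‖(y - x) + (-(r / 2)) • s⁻¹ • (z - (x + t • (y - x)))‖ ≤ r := by
        refine (norm_add_le _ _).trans ?_
        rw [norm_smul, norm_neg, Real.norm_eq_abs, abs_of_pos (half_pos hr), ← dist_eq_norm y x]
        nlinarith
      have hk : ‖(s ^ n)⁻¹ * unitBump n (s⁻¹ • (z - (x + t • (y - x))))‖ ≤
          ((r / 2) ^ n)⁻¹ * (M + 1) := by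
        rw [norm_mul, norm_inv, norm_pow, Real.norm_eq_abs, abs_of_pos hs0]
        gcongr
        exact (hM _).trans (by linarith)
      calc _ ≤ (‖g z‖ * r) * (((r / 2) ^ n)⁻¹ * (M + 1)) := by
            gcongr
            exact (norm_inner_le_norm _ _).trans (by gcongr)
        _ = _ := by
          rw [div_pow]; field_simp
    · have : unitBump n (s⁻¹ • (z - (x + t • (y - x)))) = 0 :=
        unitBump_eq_zero (bump_kernel_eq_zero hs0 hz).le
      rw [this]
      simp only [mul_zero, norm_zero]
      exact indicator_nonneg (fun _ _ => by positivity) _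

theorem volume_real_closedBall (x : EuclideanSpace ℝ (Fin n)) {r : ℝ} (hr : 0 ≤ r) :
    volume.real (Metric.closedBall x r) =
      r ^ n * volume.real (Metric.ball (0 : EuclideanSpace ℝ (Fin n)) 1) := by
  rw [Measure.real, Measure.addHaar_closedBall _ _ hr, ENNReal.toReal_mul,
    ENNReal.toReal_ofReal (by positivity), finrank_euclideanSpace_fin, Measure.real]

/-- Jensen's inequality on the ball. β^p bounds the scale-invariant energy r^(p-n) ∫|g|^p. -/
theorem exists_abs_bumpAvg_sub_le_of_rpow (n : ℕ) {p : ℝ} (hp : 1 ≤ p) : ∃ C : ℝ, 0 < C ∧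
    ∀ (v : EuclideanSpace ℝ (Fin n) → ℝ) (g : EuclideanSpace ℝ (Fin n) → EuclideanSpace ℝ (Fin n)),
    IsWeakGradientOn univ v g → Integrable (fun z => ‖g z‖ ^ p) →
    ∀ (x y : EuclideanSpace ℝ (Fin n)) (r β : ℝ), 0 < r → dist y x ≤ r / 2 → 0 ≤ β →
    r ^ p * ∫ z in Metric.closedBall x r, ‖g z‖ ^ p ≤ β ^ p * r ^ n →
    |bumpAvg v y (r / 2) - bumpAvg v x r| ≤ C * β := by
  obtain ⟨C, hC, hstep⟩ := exists_abs_bumpAvg_sub_le n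
  set V := volume.real (Metric.ball (0 : EuclideanSpace ℝ (Fin n)) 1) with hV
  have hV0 : 0 < V := ENNReal.toReal_pos (Metric.measure_ball_pos _ _ one_pos).ne'
    measure_ball_lt_top.ne
  refine ⟨C * V * (V⁻¹) ^ p⁻¹, by positivity, fun v g h hgp x y r β hr hxy hβ hG => ?_⟩
  have hp0 : 0 < p := by linarith
  refine (hstep v g h x y r hr hxy).trans ?_
  have hvol := volume_real_closedBall x hr.le
  rw [← hV] at hvol
  have hg := h.2.1
  rw [locallyIntegrableOn_univ] at hg
  have hgi : IntegrableOn g (Metric.closedBall x r) :=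
    hg.integrableOn_isCompact (isCompact_closedBall x r)
  have hJ := (convexOn_rpow hp).map_set_average_le (μ := volume) (t := Metric.closedBall x r)
    (f := fun z => ‖g z‖) (Real.continuous_rpow_const hp0.le).continuousOn isClosed_Ici
    (Metric.measure_closedBall_pos _ _ hr).ne' measure_closedBall_lt_top.ne
    (ae_of_all _ fun z => norm_nonneg (g z)) hgi.norm hgp.integrableOn
  simp only [setAverage_eq, smul_eq_mul, hvol] at hJ
  set I := ∫ z in Metric.closedBall x r, ‖g z‖
  set G := ∫ z in Metric.closedBall x r, ‖g z‖ ^ p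
  have hI0 : 0 ≤ I := integral_nonneg fun _ => norm_nonneg _
  have h1 : (r * ((r ^ n * V)⁻¹ * I)) ^ p ≤ (β * V⁻¹ ^ p⁻¹) ^ p := by
    rw [Real.mul_rpow hr.le (by positivity), Real.mul_rpow hβ (by positivity),
      ← Real.rpow_mul (by positivity), inv_mul_cancel₀ hp0.ne', Real.rpow_one]
    calc _ ≤ r ^ p * ((r ^ n * V)⁻¹ * G) := by gcongr
      _ = (r ^ p * G) * ((r ^ n)⁻¹ * V⁻¹) := by rw [mul_inv]; ring
      _ ≤ (β ^ p * r ^ n) * ((r ^ n)⁻¹ * V⁻¹) := by gcongr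
      _ = _ := by field_simp
  have h2 := (Real.rpow_le_rpow_iff (by positivity) (by positivity) hp0).1 h1
  calc C * (r / r ^ n) * I = C * V * (r * ((r ^ n * V)⁻¹ * I)) := by field_simp
    _ ≤ C * V * (β * V⁻¹ ^ p⁻¹) := by gcongr
    _ = _ := by ring

/-- Geometric decay of the normalised energy makes the averages telescope. Because `U` is open, the
average equals `c` exactly at some finite scale, so no Lebesgue points are needed. -/
theorem abs_sub_bumpAvg_le {p C : ℝ} {v : EuclideanSpace ℝ (Fin n) → ℝ}
    {g : EuclideanSpace ℝ (Fin n) → EuclideanSpace ℝ (Fin n)} (hC : 0 < C)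
    (hstep : ∀ (x y : EuclideanSpace ℝ (Fin n)) (r β : ℝ), 0 < r → dist y x ≤ r / 2 → 0 ≤ β →
      r ^ p * ∫ z in Metric.closedBall x r, ‖g z‖ ^ p ≤ β ^ p * r ^ n →
      |bumpAvg v y (r / 2) - bumpAvg v x r| ≤ C * β)
    {y : EuclideanSpace ℝ (Fin n)} {c : ℝ} {U : Set (EuclideanSpace ℝ (Fin n))} (hU : IsOpen U)
    (hy : y ∈ U) (hv : ∀ᵐ z, z ∈ U → v z = c)
    {ρ ε q : ℝ} (hρ : 0 < ρ) (hε : 0 ≤ ε) (hq0 : 0 ≤ q) (hq1 : q < 1)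
    (h : ∀ j : ℕ, (ρ / 2 ^ j) ^ p * ∫ z in Metric.closedBall y (ρ / 2 ^ j), ‖g z‖ ^ p ≤
      (ε * q ^ j) ^ p * (ρ / 2 ^ j) ^ n) :
    |c - bumpAvg v y ρ| ≤ C * ε / (1 - q) := by
  obtain ⟨δ, hδ, hball⟩ := Metric.isOpen_iff.1 hU y hy
  obtain ⟨N, hN⟩ := exists_pow_lt_of_lt_one (div_pos hδ hρ) (by norm_num : (1 / 2 : ℝ) < 1)
  have hNδ : ρ / 2 ^ N < δ := by
    rw [lt_div_iff₀ hρ, one_div, inv_pow] at hN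
    rw [div_eq_mul_inv]; linarith
  have := abs_sub_le_of_geometric (f := fun j => bumpAvg v y (ρ / 2 ^ j)) (B := C * ε)
    (by positivity) hq0 hq1 (fun j => by
      have := hstep y y (ρ / 2 ^ j) (ε * q ^ j) (by positivity) (by simp; positivity)
        (by positivity) (h j)
      rw [mul_assoc]
      convert this using 4
      rw [pow_succ, div_div]) N
  simp only [pow_zero, div_one] at this
  rwa [bumpAvg_eq_of_ae_eq (c := c) (by positivity)] at this
  filter_upwards [hv] with z hz hzb
  exact hz (hball (Metric.ball_subset_ball hNδ.le hzb))

end Telescoping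

/-! ### Capacity estimates -/

section Capacity

variable {n : ℕ}

theorem MeasureTheory.OuterMeasure.mul_le_of_setIntegral {X : Type*} [MetricSpace X]
    [TopologicalSpace.SeparableSpace X] [MeasurableSpace X] [OpensMeasurableSpace X]
    {μ : Measure X} {f : X → ℝ} (hf : Integrable f μ) (hf0 : ∀ x, 0 ≤ f x)
    (τ : OuterMeasure X) (K : ℝ≥0∞) {l : ℝ} (hl : 0 ≤ l) (k : ℕ) (ρ : ℝ)
    (hτ : ∀ y s, 0 < s → τ (Metric.closedBall y s) ≤ K * ENNReal.ofReal s ^ k) (D : Set X)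
    (hD : ∀ y ∈ D, ∃ s, 0 < s ∧ s ≤ ρ ∧ l * s ^ k ≤ ∫ z in Metric.closedBall y s, f z ∂μ) :
    ENNReal.ofReal l * τ D ≤ K * 5 ^ k * ENNReal.ofReal (∫ z, f z ∂μ) := by
  have h := OuterMeasure.mul_le_of_closedBall τ (μ.withDensity fun z => ENNReal.ofReal (f z)) K
    (ENNReal.ofReal l) k ρ hτ D (fun y hy => by
      obtain ⟨s, hs0, hsρ, hs⟩ := hD y hy
      refine ⟨s, hs0, hsρ, ?_⟩
      rw [withDensity_apply _ Metric.isClosed_closedBall.measurableSet,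
        ← ofReal_integral_eq_lintegral_ofReal hf.integrableOn (ae_of_all _ hf0),
        ← ENNReal.ofReal_pow hs0.le, ← ENNReal.ofReal_mul hl]
      exact ENNReal.ofReal_le_ofReal hs)
  rwa [withDensity_apply _ MeasurableSet.univ, Measure.restrict_univ,
    ← ofReal_integral_eq_lintegral_ofReal hf (ae_of_all _ hf0)] at h

/-- A Sobolev-type capacity estimate for `p < n`. -/
theorem exists_volume_le_of_integral_le {p : ℝ} (hp : 1 ≤ p) (hpn : p < n) :
    ∃ η C : ℝ, 0 < η ∧ 0 < C ∧
    ∀ (v : EuclideanSpace ℝ (Fin n) → ℝ) (g : EuclideanSpace ℝ (Fin n) → EuclideanSpace ℝ (Fin n)),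
    IsWeakGradientOn univ v g → Integrable (fun z => ‖g z‖ ^ p) →
    ∀ (ρ : ℝ), 0 < ρ → ∫ z, ‖g z‖ ^ p ≤ η * (ρ ^ n / ρ ^ p) →
    ∀ A D : Set (EuclideanSpace ℝ (Fin n)), IsOpen A → IsOpen D →
    (∀ᵐ z, z ∈ A → v z = 0) → (∀ᵐ z, z ∈ D → v z = 1) →
    volume A ≤ ENNReal.ofReal (C * ρ ^ n) ∨ volume D ≤ ENNReal.ofReal (C * ρ ^ n) := by
  obtain ⟨C₀, hC₀, hstep⟩ := exists_abs_bumpAvg_sub_le_of_rpow n hp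
  have hp0 : 0 < p := by linarith
  set V := volume.real (Metric.ball (0 : EuclideanSpace ℝ (Fin n)) 1) with hV
  have hV0 : 0 < V := ENNReal.toReal_pos (Metric.measure_ball_pos _ _ one_pos).ne'
    measure_ball_lt_top.ne
  -- q^p = 2^(p-n): a fixed total energy has normalised size decaying like q^j at scale ρ 2^j. Here
  -- q < 1 is the hypothesis p < n.
  set q : ℝ := 2 ^ (1 - n / p) with hq
  have hq0 : 0 < q := by positivity
  have hq1 : q < 1 := Real.rpow_lt_one_of_one_lt_of_neg (by norm_num)
    (by rw [sub_neg, one_lt_div hp0]; exact hpn)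
  have hqp : ∀ j : ℕ, (q ^ j) ^ p = (2 ^ j) ^ p / (2 ^ j) ^ n := fun j => by
    rw [← Real.rpow_natCast q, hq, ← Real.rpow_mul (by positivity), ← Real.rpow_mul (by positivity),
      ← Real.rpow_natCast 2, ← Real.rpow_mul (by norm_num), ← Real.rpow_natCast (2 ^ (j : ℝ)),
      ← Real.rpow_mul (by norm_num), ← Real.rpow_sub (by norm_num)]
    congr 1
    field_simp
  -- `ε` makes the downward chain of ratio 1/2 cost C₀ε/(1-1/2) = 1/8; `ε'` makes the upward chain
  -- of ratio q cost C₀ε'/(1-q) = 1/16.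
  set ε : ℝ := 1 / (16 * C₀) with hε
  have hε0 : 0 < ε := by positivity
  set ε' : ℝ := (1 - q) / (16 * C₀) with hε'
  have hε'0 : 0 < ε' := div_pos (by linarith) (by positivity)
  refine ⟨ε' ^ p, V * 5 ^ n * (ε' ^ p / ε ^ p), by positivity, by positivity,
    fun v g h hgp ρ hρ hG A D hA hD hvA hvD => ?_⟩
  replace hstep := hstep v g h hgp
  have hGle : ∀ (y : EuclideanSpace ℝ (Fin n)) s,
      ∫ z in Metric.closedBall y s, ‖g z‖ ^ p ≤ ε' ^ p * (ρ ^ n / ρ ^ p) := fun y s =>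
    (setIntegral_le_integral hgp (ae_of_all _ fun z => by positivity)).trans hG
  have hup : ∀ (x y : EuclideanSpace ℝ (Fin n)) (j : ℕ), dist y x ≤ ρ * 2 ^ j →
      |bumpAvg v x (ρ * 2 ^ (j + 1)) - bumpAvg v y (ρ * 2 ^ j)| ≤ C₀ * ε' * q ^ (j + 1) := by
    intro x y j hxy
    have e : ρ * 2 ^ (j + 1) / 2 = ρ * 2 ^ j := by rw [pow_succ]; ring
    rw [abs_sub_comm, mul_assoc, ← e]
    refine hstep x y _ _ (by positivity) (by rwa [e]) (by positivity) ?_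
    refine (mul_le_mul_of_nonneg_left (hGle _ _) (by positivity)).trans_eq ?_
    rw [Real.mul_rpow hρ.le (by positivity), Real.mul_rpow hε'0.le (by positivity), hqp, mul_pow]
    field_simp
  -- All averages at scale ρ centred in a large ball are close to one number, the average about the
  -- origin at a still larger scale.
  have hgood : ∀ (N : ℕ) (y : EuclideanSpace ℝ (Fin n)), dist y 0 ≤ ρ * 2 ^ N →
      |bumpAvg v 0 (ρ * 2 ^ (N + 1)) - bumpAvg v y ρ| ≤ 1 / 8 := by
    intro N y hy
    have h1 := hup 0 y N hy
    have h2 := abs_sub_le_of_geometric (f := fun j => bumpAvg v y (ρ * 2 ^ j)) (B := C₀ * ε')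
      (by positivity) hq0.le hq1 (fun j => (hup y y j (by simp; positivity)).trans (by
        gcongr ?_ * ?_
        exact pow_le_pow_of_le_one hq0.le hq1.le (Nat.le_succ j))) N
    have h3 : C₀ * ε' / (1 - q) = 1 / 16 := by
      have : 1 - q ≠ 0 := by linarith
      rw [hε']; field_simp
    have h4 : C₀ * ε' * q ^ (N + 1) ≤ 1 / 16 := by
      have : C₀ * ε' * q ^ (N + 1) ≤ C₀ * ε' * 1 := by
        gcongr
        exact pow_le_one₀ hq0.le hq1.le
      refine this.trans ?_
      rw [← h3, mul_one, le_div_iff₀ (by linarith)]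
      have : 0 < C₀ * ε' := by positivity
      nlinarith
    simp only [pow_zero, mul_one] at h2
    rw [h3] at h2
    calc _ ≤ _ := abs_sub_le _ (bumpAvg v y (ρ * 2 ^ N)) _
      _ ≤ 1 / 16 + 1 / 16 := add_le_add (h1.trans h4) h2
      _ = 1 / 8 := by norm_num
  -- A set where v = c while the averages at scale ρ stay away from c is small. Each of its points
  -- has a ball of radius s ≤ ρ with energy at least (ε/ρ)^p s^n, since otherwise the downward chain
  -- would bring the average within 1/8 of c.
  have hbad : ∀ (c : ℝ) (U : Set (EuclideanSpace ℝ (Fin n))), IsOpen U →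
      (∀ᵐ z, z ∈ U → v z = c) → (∀ y ∈ U, 1 / 8 < |c - bumpAvg v y ρ|) →
      volume U ≤ ENNReal.ofReal (V * 5 ^ n * (ε' ^ p / ε ^ p) * ρ ^ n) := by
    intro c U hU hvU hy
    have hVit := OuterMeasure.mul_le_of_setIntegral hgp (fun z => by positivity)
      (volume : Measure (EuclideanSpace ℝ (Fin n))).toOuterMeasure (ENNReal.ofReal V)
      (l := (ε / ρ) ^ p) (by positivity) n ρ (fun y s hs => by
        rw [Measure.coe_toOuterMeasure, Measure.addHaar_closedBall _ _ hs.le,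
          finrank_euclideanSpace_fin, ENNReal.ofReal_pow hs.le, hV,
          ofReal_measureReal measure_ball_lt_top.ne, mul_comm]) U (fun y hyU => by
        by_contra! hcon
        refine absurd (abs_sub_bumpAvg_le hC₀ hstep hU hyU hvU hρ hε0.le
          (q := 1 / 2) (by norm_num) (by norm_num) fun j => ?_) (not_le.2 ?_)
        · have := hcon (ρ / 2 ^ j) (by positivity)
            (div_le_self hρ.le (one_le_pow₀ (by norm_num)))
          refine (mul_le_mul_of_nonneg_left this.le (by positivity)).trans_eq ?_
          rw [← mul_assoc, ← Real.mul_rpow (by positivity) (by positivity)]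
          congr 2
          rw [one_div, inv_pow]
          field_simp
        · have : C₀ * ε / (1 - 1 / 2) = 1 / 8 := by rw [hε]; field_simp; norm_num
          rw [this]; exact hy y hyU)
    rw [Measure.coe_toOuterMeasure] at hVit
    have hl0 : 0 < (ε / ρ) ^ p := by positivity
    have h1 : ENNReal.ofReal ((ε / ρ) ^ p) * volume U ≤
        ENNReal.ofReal ((ε / ρ) ^ p) *
          ENNReal.ofReal (V * 5 ^ n * (ε' ^ p / ε ^ p) * ρ ^ n) := by
      refine hVit.trans ?_
      rw [← ENNReal.ofReal_mul hl0.le]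
      have h5 : (5 : ℝ≥0∞) ^ n = ENNReal.ofReal (5 ^ n) := by
        rw [ENNReal.ofReal_pow (by norm_num)]; norm_num
      rw [h5, ← ENNReal.ofReal_mul hV0.le, ← ENNReal.ofReal_mul (by positivity)]
      apply ENNReal.ofReal_le_ofReal
      refine (mul_le_mul_of_nonneg_left hG (by positivity)).trans_eq ?_
      rw [Real.div_rpow hε0.le hρ.le]
      field_simp
    exact (ENNReal.mul_le_mul_iff_right (by positivity) ENNReal.ofReal_ne_top).1 h1
  by_contra! hcon
  obtain ⟨hcA, hcD⟩ := hcon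
  have hcover : ⋃ N : ℕ, Metric.ball (0 : EuclideanSpace ℝ (Fin n)) (ρ * 2 ^ N) = univ := by
    refine eq_univ_of_forall fun y => ?_
    obtain ⟨N, hN⟩ := pow_unbounded_of_one_lt (dist y 0 / ρ) (by norm_num : (1 : ℝ) < 2)
    refine mem_iUnion.2 ⟨N, ?_⟩
    rw [div_lt_iff₀ hρ] at hN
    rw [Metric.mem_ball]; linarith
  have hmono : Monotone fun N : ℕ => Metric.ball (0 : EuclideanSpace ℝ (Fin n)) (ρ * 2 ^ N) :=
    fun i j hij => Metric.ball_subset_ball (by gcongr; norm_num)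
  -- `A` and `D` may be unbounded. Bounded pieces of them already exceed the volume bound, so a
  -- single `N` can serve for both.
  have hex : ∀ (U : Set (EuclideanSpace ℝ (Fin n))) (b : ℝ≥0∞), b < volume U →
      ∃ N : ℕ, b < volume (U ∩ Metric.ball 0 (ρ * 2 ^ N)) := by
    intro U b hb
    rw [← inter_univ U, ← hcover, inter_iUnion, Monotone.measure_iUnion] at hb
    · exact lt_iSup_iff.1 hb
    · exact fun i j hij => inter_subset_inter_right _ (hmono hij)
  obtain ⟨N₁, hN₁⟩ := hex A _ hcA
  obtain ⟨N₂, hN₂⟩ := hex D _ hcD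
  set N := max N₁ N₂
  have hpt : ∀ (c : ℝ) (U : Set (EuclideanSpace ℝ (Fin n))) (M : ℕ), M ≤ N → IsOpen U →
      (∀ᵐ z, z ∈ U → v z = c) → ENNReal.ofReal (V * 5 ^ n * (ε' ^ p / ε ^ p) * ρ ^ n) <
        volume (U ∩ Metric.ball 0 (ρ * 2 ^ M)) →
      |bumpAvg v 0 (ρ * 2 ^ (N + 1)) - c| ≤ 1 / 4 := by
    intro c U M hM hU hvU hlt
    have : ∃ y ∈ U ∩ Metric.ball 0 (ρ * 2 ^ M), |c - bumpAvg v y ρ| ≤ 1 / 8 := by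
      by_contra! hc
      refine absurd (hbad c _ (hU.inter Metric.isOpen_ball) ?_ hc) (not_le.2 hlt)
      filter_upwards [hvU] with z hz hz2 using hz hz2.1
    obtain ⟨y, hy, hyc⟩ := this
    have h1 := hgood N y (le_of_lt (hmono hM hy.2))
    rw [abs_sub_comm] at hyc
    calc _ ≤ _ := abs_sub_le _ (bumpAvg v y ρ) _
      _ ≤ 1 / 8 + 1 / 8 := add_le_add h1 hyc
      _ = 1 / 4 := by norm_num
  have h0 := abs_le.1 (hpt 0 A N₁ (le_max_left _ _) hA hvA hN₁)
  have h1 := abs_le.1 (hpt 1 D N₂ (le_max_right _ _) hD hvD hN₂)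
  linarith [h0.2, h1.1]

/-- A lower bound for the energy of a function separating two sets that meet many spheres, for
`p > n - 1`. -/
theorem exists_mul_pow_le_integral {p : ℝ} (hp : 1 ≤ p) (hpn : (n : ℝ) - 1 < p) :
    ∃ c : ℝ, 0 < c ∧
    ∀ (v : EuclideanSpace ℝ (Fin n) → ℝ) (g : EuclideanSpace ℝ (Fin n) → EuclideanSpace ℝ (Fin n)),
    IsWeakGradientOn univ v g → Integrable (fun z => ‖g z‖ ^ p) →
    ∀ (x : EuclideanSpace ℝ (Fin n)) (r : ℝ), 0 < r →
    ∀ A D : Set (EuclideanSpace ℝ (Fin n)), IsOpen A → IsOpen D →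
    A ⊆ Metric.ball x (r / 2) → D ⊆ Metric.ball x (r / 2) →
    ENNReal.ofReal (r / 8) ≤ volume ((fun z => dist z x) '' A) →
    ENNReal.ofReal (r / 8) ≤ volume ((fun z => dist z x) '' D) →
    (∀ᵐ z, z ∈ A → v z = 0) → (∀ᵐ z, z ∈ D → v z = 1) →
    c * r ^ n ≤ r ^ p * ∫ z, ‖g z‖ ^ p := by
  obtain ⟨C₀, hC₀, hstep⟩ := exists_abs_bumpAvg_sub_le_of_rpow n hp
  have hp0 : 0 < p := by linarith
  -- q^p = 2^(n-1-p) is the decay of the normalised energy when a ball of radius s carries energy at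
  -- most a constant times s. Here q < 1 is the hypothesis p > n-1.
  set q : ℝ := 2 ^ (-(p + 1 - n) / p) with hq
  have hq0 : 0 < q := by positivity
  have hq1 : q < 1 := Real.rpow_lt_one_of_one_lt_of_neg (by norm_num)
    (div_neg_of_neg_of_pos (by linarith) hp0)
  have hqp : ∀ j : ℕ, (q ^ j) ^ p = (2 ^ j) ^ n / ((2 ^ j) ^ p * 2 ^ j) := fun j => by
    have e : ((2 : ℝ) ^ (j : ℝ)) ^ p * 2 ^ (j : ℝ) = 2 ^ (j * (p + 1)) := by
      rw [← Real.rpow_mul (by norm_num), ← Real.rpow_add (by norm_num)]; ring_nf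
    rw [← Real.rpow_natCast q, hq, ← Real.rpow_mul (by positivity), ← Real.rpow_mul (by positivity),
      ← Real.rpow_natCast 2, e, ← Real.rpow_natCast (2 ^ (j : ℝ)),
      ← Real.rpow_mul (by norm_num), ← Real.rpow_sub (by norm_num)]
    congr 1
    field_simp
    ring
  set ε : ℝ := (1 - q) / (8 * C₀) with hε
  have hε0 : 0 < ε := div_pos (by linarith) (by positivity)
  have hεC : C₀ * ε / (1 - q) = 1 / 8 := by
    have : 1 - q ≠ 0 := by linarith
    rw [hε]; field_simp
  set β : ℝ := 1 / (8 * C₀) with hβ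
  have hβ0 : 0 < β := by positivity
  -- β^p pays for the step from scale r/2 at y to scale r at x. In the other term 40 = 10 · 4: the
  -- covering loses 2 · 5, and the radial length r/8 is a quarter of r/2.
  refine ⟨min (β ^ p) (ε ^ p * (2 ^ p / 2 ^ n) / 40), by positivity,
    fun v g h hgp x r hr A D hA hD hAx hDx hAr hDr hvA hvD => ?_⟩
  replace hstep := hstep v g h hgp
  by_contra! hcon
  have hG0 : 0 ≤ ∫ z, ‖g z‖ ^ p := integral_nonneg fun z => by positivity
  have hcon1 : r ^ p * ∫ z, ‖g z‖ ^ p < β ^ p * r ^ n :=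
    hcon.trans_le (by gcongr; exact min_le_left _ _)
  have hcon2 : r ^ p * ∫ z, ‖g z‖ ^ p < ε ^ p * (2 ^ p / 2 ^ n) / 40 * r ^ n :=
    hcon.trans_le (by gcongr; exact min_le_right _ _)
  have hpt : ∀ (c : ℝ) (U : Set (EuclideanSpace ℝ (Fin n))), IsOpen U →
      U ⊆ Metric.ball x (r / 2) → ENNReal.ofReal (r / 8) ≤ volume ((fun z => dist z x) '' U) →
      (∀ᵐ z, z ∈ U → v z = c) → |bumpAvg v x r - c| ≤ 1 / 4 := by
    intro c U hU hUx hUr hvU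
    have : ∃ y ∈ U, |c - bumpAvg v y (r / 2)| ≤ 1 / 8 := by
      by_contra! hc
      -- The outer measure is the length of the radial projection. Distance to x is 1-Lipschitz, so
      -- a ball of radius s projects into an interval of length 2s.
      have hVit := OuterMeasure.mul_le_of_setIntegral hgp (fun z => by positivity)
        (OuterMeasure.comap (fun z => dist z x) (volume : Measure ℝ).toOuterMeasure) 2
        (l := ε ^ p * ((r / 2) ^ n / ((r / 2) ^ p * (r / 2)))) (by positivity) 1 (r / 2)
        (fun y s hs => by
          rw [OuterMeasure.comap_apply, Measure.coe_toOuterMeasure]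
          have : (fun z => dist z x) '' Metric.closedBall y s ⊆
              Metric.closedBall (dist y x) s := by
            rintro _ ⟨z, hz, rfl⟩
            rw [Metric.mem_closedBall] at hz ⊢
            exact (dist_dist_dist_le_left _ _ _).trans hz
          refine (measure_mono this).trans_eq ?_
          rw [Real.volume_closedBall, ENNReal.ofReal_mul (by norm_num)]
          norm_num) U (fun y hyU => by
          by_contra! hcon
          refine absurd (abs_sub_bumpAvg_le hC₀ hstep hU hyU hvU (half_pos hr) hε0.le
            hq0.le hq1 fun j => ?_) (not_le.2 ?_)
          · have := hcon (r / 2 / 2 ^ j) (by positivity)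
              (div_le_self (half_pos hr).le (one_le_pow₀ (by norm_num)))
            refine (mul_le_mul_of_nonneg_left this.le (by positivity)).trans_eq ?_
            rw [Real.mul_rpow hε0.le (by positivity), hqp,
              Real.div_rpow (half_pos hr).le (by positivity), div_pow (r / 2) (2 ^ j) n]
            field_simp
          · rw [hεC]; exact hc y hyU)
      rw [OuterMeasure.comap_apply, Measure.coe_toOuterMeasure] at hVit
      have h1 := (mul_le_mul_right hUr _).trans hVit
      rw [← ENNReal.ofReal_mul (by positivity)] at h1
      have h5 : (2 : ℝ≥0∞) * 5 ^ 1 = ENNReal.ofReal 10 := by norm_num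
      rw [h5, ← ENNReal.ofReal_mul (by norm_num), ENNReal.ofReal_le_ofReal_iff (by positivity)]
        at h1
      have h2 : r ^ p * (ε ^ p * ((r / 2) ^ n / ((r / 2) ^ p * (r / 2))) * (r / 8)) =
          10 * (ε ^ p * (2 ^ p / 2 ^ n) / 40 * r ^ n) := by
        rw [Real.div_rpow hr.le (by norm_num), div_pow]
        field_simp
        norm_num
      have h3 := mul_le_mul_of_nonneg_left h1 (by positivity : 0 ≤ r ^ p)
      linarith
    obtain ⟨y, hy, hyc⟩ := this
    have h1 := hstep x y r β hr (le_of_lt (hUx hy)) hβ0.le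
      ((mul_le_mul_of_nonneg_left (setIntegral_le_integral hgp
        (ae_of_all _ fun z => by positivity)) (by positivity)).trans hcon1.le)
    have h2 : C₀ * β = 1 / 8 := by rw [hβ]; field_simp
    rw [h2, abs_sub_comm] at h1
    rw [abs_sub_comm] at hyc
    calc _ ≤ _ := abs_sub_le _ (bumpAvg v y (r / 2)) _
      _ ≤ 1 / 8 + 1 / 8 := add_le_add h1 hyc
      _ = 1 / 4 := by norm_num
  have h0 := abs_le.1 (hpt 0 A hA hAx hAr hvA)
  have h1 := abs_le.1 (hpt 1 D hD hDx hDr hvD)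
  linarith [h0.2, h1.1]

end Capacity

/-! ### Smooth cutoff functions -/

section Cutoff

theorem exists_bound_deriv_smoothTransition :
    ∃ L : ℝ, 0 < L ∧ ∀ x, |deriv Real.smoothTransition x| ≤ L := by
  have hcd : ContDiff ℝ 1 Real.smoothTransition := Real.smoothTransition.contDiff
  have hc : Continuous (deriv Real.smoothTransition) := hcd.continuous_deriv le_rfl
  have hs : HasCompactSupport (deriv Real.smoothTransition) := by
    refine HasCompactSupport.of_support_subset_isCompact (isCompact_Icc (a := (0 : ℝ)) (b := 1)) ?_
    intro x hx
    by_contra h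
    apply hx
    rw [mem_Icc, not_and_or, not_le, not_le] at h
    rcases h with h | h
    · have : Real.smoothTransition =ᶠ[nhds x] fun _ => 0 := by
        filter_upwards [Iio_mem_nhds h] with y hy
        exact Real.smoothTransition.zero_of_nonpos (le_of_lt hy)
      rw [this.deriv_eq]; simp
    · have : Real.smoothTransition =ᶠ[nhds x] fun _ => 1 := by
        filter_upwards [Ioi_mem_nhds h] with y hy
        exact Real.smoothTransition.one_of_one_le (le_of_lt hy)
      rw [this.deriv_eq]; simp
  obtain ⟨L, hL⟩ := hs.exists_bound_of_continuous hc
  exact ⟨L + 1, by linarith [(norm_nonneg _).trans (hL 0)], fun x => (hL x).trans (by linarith)⟩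

/-- A profile of the squared distance is smooth at the centre as well. Its slope is controlled by
2t/(t²-s²) ≤ 2/(t-s). -/
theorem exists_cutoff (n : ℕ) : ∃ L : ℝ, 0 < L ∧ ∀ (x : EuclideanSpace ℝ (Fin n)) (s t : ℝ),
    0 ≤ s → s < t → ∃ ψ : EuclideanSpace ℝ (Fin n) → ℝ, ContDiff ℝ ∞ ψ ∧
      (∀ z ∈ Metric.ball x s, ψ z = 1) ∧ (∀ z ∉ Metric.ball x t, ψ z = 0) ∧
      (∀ z ∉ Metric.ball x t, fderiv ℝ ψ z = 0) ∧ ∀ z, ‖fderiv ℝ ψ z‖ ≤ L / (t - s) := by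
  obtain ⟨L, hL0, hL⟩ := exists_bound_deriv_smoothTransition
  refine ⟨2 * L, by positivity, fun x s t hs hst => ?_⟩
  have hd : 0 < t ^ 2 - s ^ 2 := by nlinarith
  have hf : ∀ z : EuclideanSpace ℝ (Fin n),
      HasFDerivAt (fun z => (t ^ 2 - ‖z - x‖ ^ 2) / (t ^ 2 - s ^ 2))
        ((t ^ 2 - s ^ 2)⁻¹ • -((2 : ℝ) • innerSL ℝ (z - x))) z := fun z => by
    have h1 : HasFDerivAt (fun z : EuclideanSpace ℝ (Fin n) => ‖z - x‖ ^ 2)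
        ((2 : ℝ) • innerSL ℝ (z - x)) z := by
      refine ((hasStrictFDerivAt_norm_sq (z - x)).hasFDerivAt.comp z
        ((hasFDerivAt_id z).sub_const x)).congr_fderiv ?_
      ext w
      simp
    have h2 := (h1.const_sub (t ^ 2)).const_smul ((t ^ 2 - s ^ 2)⁻¹)
    refine h2.congr_of_eventuallyEq (Filter.Eventually.of_forall fun w => ?_)
    simp only [Pi.smul_apply, smul_eq_mul]
    rw [div_eq_inv_mul]
  have hcd : ContDiff ℝ ∞ (fun z : EuclideanSpace ℝ (Fin n) =>
      Real.smoothTransition ((t ^ 2 - ‖z - x‖ ^ 2) / (t ^ 2 - s ^ 2))) :=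
    Real.smoothTransition.contDiff.comp
      ((contDiff_const.sub ((contDiff_id.sub contDiff_const).norm_sq ℝ)).div_const _)
  have hzero : ∀ z ∉ Metric.ball x t,
      Real.smoothTransition ((t ^ 2 - ‖z - x‖ ^ 2) / (t ^ 2 - s ^ 2)) = 0 := fun z hz => by
    rw [Metric.mem_ball, dist_eq_norm, not_lt] at hz
    exact Real.smoothTransition.zero_of_nonpos
      (div_nonpos_of_nonpos_of_nonneg (by nlinarith) hd.le)
  -- The function is nonnegative, so each zero is a minimum; this includes the boundary sphere.
  have hdzero : ∀ z ∉ Metric.ball x t, fderiv ℝ (fun z : EuclideanSpace ℝ (Fin n) =>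
      Real.smoothTransition ((t ^ 2 - ‖z - x‖ ^ 2) / (t ^ 2 - s ^ 2))) z = 0 := fun z hz => by
    refine IsLocalMin.fderiv_eq_zero (Filter.Eventually.of_forall fun w => ?_)
    simp only [hzero z hz]
    exact Real.smoothTransition.nonneg _
  refine ⟨_, hcd, fun z hz => ?_, hzero, hdzero, fun z => ?_⟩
  · rw [Metric.mem_ball, dist_eq_norm] at hz
    refine Real.smoothTransition.one_of_one_le ((one_le_div hd).2 ?_)
    have := norm_nonneg (z - x)
    nlinarith
  · by_cases hz : z ∈ Metric.ball x t
    · have hS : ContDiff ℝ 1 Real.smoothTransition := Real.smoothTransition.contDiff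
      have h1 := ((hS.differentiable (by simp)
        ((t ^ 2 - ‖z - x‖ ^ 2) / (t ^ 2 - s ^ 2))).hasDerivAt.comp_hasFDerivAt z (hf z)).fderiv
      rw [Metric.mem_ball, dist_eq_norm] at hz
      change ‖fderiv ℝ (Real.smoothTransition ∘ _) z‖ ≤ _
      rw [h1, norm_smul, norm_smul, norm_neg, norm_smul,
        innerSL_apply_norm, norm_inv, Real.norm_eq_abs (t ^ 2 - s ^ 2), abs_of_pos hd]
      have h2 : (t ^ 2 - s ^ 2)⁻¹ * (2 * t) ≤ 2 / (t - s) := by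
        rw [inv_mul_eq_div, div_le_div_iff₀ hd (by linarith)]
        nlinarith
      calc _ ≤ L * ((t ^ 2 - s ^ 2)⁻¹ * (2 * t)) := by
            gcongr
            · exact hL _
            · simp
        _ ≤ L * (2 / (t - s)) := by gcongr
        _ = _ := by ring
    · rw [hdzero z hz, norm_zero]
      exact div_nonneg (by positivity) (by linarith)

end Cutoff

/-! ### Openness of the remaining components -/

section Components

theorem isOpen_diff_connectedComponentIn {X : Type*} [TopologicalSpace X]
    [LocallyConnectedSpace X] {S : Set X} (hS : IsOpen S) (y : X) :
    IsOpen (S \ connectedComponentIn S y) := by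
  rw [isOpen_iff_mem_nhds]
  rintro z ⟨hz, hzy⟩
  refine Filter.mem_of_superset
    ((hS.connectedComponentIn (x := z)).mem_nhds (mem_connectedComponentIn hz)) fun w hw => ?_
  refine ⟨connectedComponentIn_subset _ _ hw, fun hw' => hzy ?_⟩
  rw [connectedComponentIn_eq hw', ← connectedComponentIn_eq hw]
  exact mem_connectedComponentIn hz

end Components

/-! ### Weak gradients -/

section WeakGradient

variable {n : ℕ} {Ω : Set (EuclideanSpace ℝ (Fin n))}

/-- `HomSobolev.weakGrad` is an arbitrary choice; uniqueness allows it to be computed for the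
cutoff. -/
theorem IsWeakGradientOn.ae_eq (hΩ : IsOpen Ω) {u : EuclideanSpace ℝ (Fin n) → ℝ}
    {g₁ g₂ : EuclideanSpace ℝ (Fin n) → EuclideanSpace ℝ (Fin n)}
    (h₁ : IsWeakGradientOn Ω u g₁) (h₂ : IsWeakGradientOn Ω u g₂) :
    g₁ =ᵐ[volume.restrict Ω] g₂ := by
  have hloc : ∀ {g : EuclideanSpace ℝ (Fin n) → EuclideanSpace ℝ (Fin n)} (i : Fin n),
      LocallyIntegrableOn g Ω volume → LocallyIntegrableOn (fun x => g x i) Ω volume := by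
    intro g i hg x hx
    obtain ⟨U, hU, hgU⟩ := hg x hx
    exact ⟨U, hU, (EuclideanSpace.proj (𝕜 := ℝ) i).integrable_comp hgU⟩
  have hi : ∀ i : Fin n, ∀ᵐ x, x ∈ Ω → g₁ x i - g₂ x i = 0 := by
    intro i
    refine hΩ.ae_eq_zero_of_integral_contDiff_smul_eq_zero
      ((hloc i h₁.2.1).sub (hloc i h₂.2.1)) fun φ hφ hc hsub => ?_
    have e := (h₁.2.2 φ hφ hc hsub i).symm.trans (h₂.2.2 φ hφ hc hsub i)
    have hK : ∀ {g : EuclideanSpace ℝ (Fin n) → EuclideanSpace ℝ (Fin n)},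
        LocallyIntegrableOn g Ω volume →
        IntegrableOn (fun x => g x i * φ x) (tsupport φ) volume := fun {g} hg =>
      ((hloc i hg).integrableOn_compact_subset hsub hc).mul_continuousOn
        hφ.continuous.continuousOn hc
    have hrestr : ∀ {g : EuclideanSpace ℝ (Fin n) → EuclideanSpace ℝ (Fin n)},
        ∫ x in Ω, g x i * φ x = ∫ x in tsupport φ, g x i * φ x := fun {g} => by
      rw [setIntegral_eq_integral_of_forall_compl_eq_zero,
        setIntegral_eq_integral_of_forall_compl_eq_zero]
      · intro x hx; rw [image_eq_zero_of_notMem_tsupport hx, mul_zero]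
      · intro x hx; rw [image_eq_zero_of_notMem_tsupport fun h => hx (hsub h), mul_zero]
    rw [neg_inj, hrestr, hrestr] at e
    rw [← setIntegral_eq_integral_of_forall_compl_eq_zero (s := tsupport φ)]
    · simp_rw [smul_eq_mul, mul_sub, mul_comm (φ _)]
      rw [integral_sub (hK h₁.2.1) (hK h₂.2.1), e, sub_self]
    · intro x hx; rw [image_eq_zero_of_notMem_tsupport hx, zero_smul]
  rw [Filter.EventuallyEq, ae_restrict_iff' hΩ.measurableSet]
  filter_upwards [ae_all_iff.2 hi] with x hx hxΩ
  ext i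
  exact sub_eq_zero.1 (hx i hxΩ)

theorem IsWeakGradientOn.congr_ae {u w : EuclideanSpace ℝ (Fin n) → ℝ}
    {g : EuclideanSpace ℝ (Fin n) → EuclideanSpace ℝ (Fin n)} (h : IsWeakGradientOn Ω u g)
    (huw : u =ᵐ[volume.restrict Ω] w) : IsWeakGradientOn Ω w g := by
  refine ⟨fun x hx => ?_, h.2.1, fun φ hφ hc hsub i => ?_⟩
  · obtain ⟨U, hU, hint⟩ := h.1 x hx
    refine ⟨U ∩ Ω, Filter.inter_mem hU self_mem_nhdsWithin, ?_⟩
    exact (hint.mono_set inter_subset_left).congr_fun_ae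
      (ae_mono (Measure.restrict_mono_set _ inter_subset_right) huw)
  · rw [← h.2.2 φ hφ hc hsub i]
    refine integral_congr_ae ?_
    filter_upwards [huw] with x hx
    rw [hx]

/-- `hzero` excludes a jump across ∂A inside Ω. Hence the truncated product of ψ with a test
function is differentiable everywhere, and its derivative integrates to zero. -/
theorem isWeakGradientOn_indicator {A : Set (EuclideanSpace ℝ (Fin n))}
    (hA : IsOpen A) (hAΩ : A ⊆ Ω) {ψ : EuclideanSpace ℝ (Fin n) → ℝ} (hψ : ContDiff ℝ ∞ ψ)
    (hzero : ∀ z ∈ Ω, z ∉ A → ∀ᶠ w in nhds z, A.indicator ψ w = 0) :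
    IsWeakGradientOn Ω (A.indicator ψ) (A.indicator (gradient ψ)) := by
  have hgc : Continuous (gradient ψ) :=
    (InnerProductSpace.toDual ℝ _).symm.continuous.comp (hψ.continuous_fderiv (by simp))
  refine ⟨(hψ.continuous.locallyIntegrable.indicator hA.measurableSet).locallyIntegrableOn _,
    (hgc.locallyIntegrable.indicator hA.measurableSet).locallyIntegrableOn _,
    fun φ hφ hc hsub i => ?_⟩
  set e : EuclideanSpace ℝ (Fin n) := EuclideanSpace.single i 1
  have hgrad : ∀ z, gradient ψ z i = fderiv ℝ ψ z e := fun z => by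
    have h1 : inner ℝ (gradient ψ z) e = fderiv ℝ ψ z e := by
      rw [gradient, InnerProductSpace.toDual_symm_apply]
    rw [← h1, EuclideanSpace.inner_single_right]
    simp
  have hdψ : ∀ z, HasFDerivAt ψ (fderiv ℝ ψ z) z := fun z =>
    (hψ.differentiable (by simp) z).hasFDerivAt
  have hdφ : ∀ z, HasFDerivAt φ (fderiv ℝ φ z) z := fun z =>
    (hφ.differentiable (by simp) z).hasFDerivAt
  have hI1 : Integrable (fun z => ψ z * fderiv ℝ φ z e) :=
    (hψ.continuous.mul ((hφ.continuous_fderiv (by simp)).clm_apply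
      continuous_const)).integrable_of_hasCompactSupport (hc.fderiv_apply ℝ e).mul_left
  have hI2 : Integrable (fun z => φ z * fderiv ℝ ψ z e) :=
    (hφ.continuous.mul ((hψ.continuous_fderiv (by simp)).clm_apply
      continuous_const)).integrable_of_hasCompactSupport hc.mul_right
  have hI3 : Integrable (A.indicator fun z => ψ z * φ z) :=
    ((hψ.continuous.mul hφ.continuous).integrable_of_hasCompactSupport hc.mul_left).indicator
      hA.measurableSet
  have hD : ∀ z, HasFDerivAt (A.indicator fun z => ψ z * φ z)
      (A.indicator (fun z => ψ z • fderiv ℝ φ z + φ z • fderiv ℝ ψ z) z) z := by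
    intro z
    by_cases hz : z ∈ A
    · rw [indicator_of_mem hz]
      refine ((hdψ z).mul (hdφ z)).congr_of_eventuallyEq ?_
      filter_upwards [hA.mem_nhds hz] with w hw
      rw [indicator_of_mem hw]
      rfl
    · rw [indicator_of_notMem hz]
      refine (hasFDerivAt_const (0 : ℝ) z).congr_of_eventuallyEq ?_
      by_cases hzφ : z ∈ tsupport φ
      · filter_upwards [hzero z (hsub hzφ) hz] with w hw
        by_cases hwA : w ∈ A
        · rw [indicator_of_mem hwA] at hw ⊢
          rw [hw, zero_mul]
        · rw [indicator_of_notMem hwA]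
      · filter_upwards [notMem_tsupport_iff_eventuallyEq.1 hzφ] with w hw
        rw [indicator_apply_eq_zero]
        intro _
        rw [hw, Pi.zero_apply, mul_zero]
  have hfd : ∀ z, fderiv ℝ (A.indicator fun z => ψ z * φ z) z e =
      A.indicator (fun z => ψ z * fderiv ℝ φ z e + φ z * fderiv ℝ ψ z e) z := fun z => by
    rw [(hD z).fderiv]
    by_cases hz : z ∈ A
    · simp [indicator_of_mem hz]
    · simp [indicator_of_notMem hz]
  have hI4 : Integrable fun z => fderiv ℝ (A.indicator fun z => ψ z * φ z) z e := by
    simp_rw [hfd]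
    exact (hI1.add hI2).indicator hA.measurableSet
  have hparts := integral_mul_fderiv_eq_neg_fderiv_mul_of_integrable (μ := volume)
    (f := A.indicator fun z => ψ z * φ z) (g := fun _ => (1 : ℝ)) (v := e)
    (by simpa using hI4) (by simp) (by simpa using hI3)
    (fun z _ => (hD z).differentiableAt) (fun z _ => differentiableAt_const _)
  simp only [fderiv_fun_const, Pi.zero_apply, zero_apply, mul_zero,
    integral_zero, mul_one, hfd] at hparts
  rw [integral_indicator hA.measurableSet, integral_add hI1.integrableOn hI2.integrableOn]
    at hparts
  have e1 : ∫ z in Ω, A.indicator ψ z * fderiv ℝ φ z e = ∫ z in A, ψ z * fderiv ℝ φ z e := by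
    rw [← integral_indicator hA.measurableSet, ← setIntegral_eq_integral_of_forall_compl_eq_zero
      (s := Ω) (f := A.indicator _)]
    · simp_rw [indicator_mul_left]
    · exact fun z hz => indicator_of_notMem (fun h => hz (hAΩ h)) _
  have e2 : ∫ z in Ω, A.indicator (gradient ψ) z i * φ z = ∫ z in A, φ z * fderiv ℝ ψ z e := by
    rw [← integral_indicator hA.measurableSet, ← setIntegral_eq_integral_of_forall_compl_eq_zero
      (s := Ω) (f := A.indicator _)]
    · refine integral_congr_ae (ae_of_all _ fun z => ?_)
      by_cases hz : z ∈ A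
      · simp [indicator_of_mem hz, hgrad, mul_comm]
      · simp [indicator_of_notMem hz]
    · exact fun z hz => indicator_of_notMem (fun h => hz (hAΩ h)) _
  rw [e1, e2]
  linarith

end WeakGradient

/-! ### Extending the cutoff -/

section Extension

variable {n : ℕ} {Ω : Set (EuclideanSpace ℝ (Fin n))} {p : ℝ}

theorem HomSobolev.seminorm_nonneg (u : HomSobolev Ω p) : 0 ≤ HomSobolev.seminorm u :=
  Real.rpow_nonneg (integral_nonneg fun _ => by positivity) _

theorem HomSobolev.seminorm_rpow (hp : 1 ≤ p) (u : HomSobolev Ω p) :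
    HomSobolev.seminorm u ^ p = ∫ x in Ω, ‖HomSobolev.weakGrad u x‖ ^ p := by
  rw [HomSobolev.seminorm, ← Real.rpow_mul (integral_nonneg fun _ => by positivity),
    one_div, inv_mul_cancel₀ (by linarith), Real.rpow_one]

/-- The infimum is attained, so the estimates can use `extensionNorm E` itself. If the seminorm of u
is zero, any admissible constant already forces that of E u to vanish. -/
theorem extensionNorm_mem_extensionConstants
    {E : HomSobolev Ω p → HomSobolev (univ : Set (EuclideanSpace ℝ (Fin n))) p}
    (hE : (extensionConstants E).Nonempty) : extensionNorm E ∈ extensionConstants E := by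
  refine ⟨le_csInf hE fun C hC => hC.1, fun u => ?_⟩
  rcases (HomSobolev.seminorm_nonneg u).eq_or_lt with h | h
  · obtain ⟨C, hC⟩ := hE
    have := hC.2 u
    rw [← h, mul_zero] at this ⊢
    exact this
  · rw [← div_le_iff₀ h]
    exact le_csInf hE fun C hC => (div_le_iff₀ h).2 (hC.2 u)

theorem IsExtensionOperator.one_le_extensionNorm
    {E : HomSobolev Ω p → HomSobolev (univ : Set (EuclideanSpace ℝ (Fin n))) p}
    (hE : IsExtensionOperator E) : 1 ≤ extensionNorm E :=
  (extensionNorm_mem_extensionConstants hE.2).1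

/-- The extension of a cutoff function on a component of `Ω ∩ B(x, r)`. -/
theorem exists_extension_cutoff (n : ℕ) {p : ℝ} (hp : 1 ≤ p) : ∃ L : ℝ, 0 < L ∧
    ∀ Ω : Set (EuclideanSpace ℝ (Fin n)), IsOpen Ω →
    ∀ E : HomSobolev Ω p → HomSobolev (univ : Set (EuclideanSpace ℝ (Fin n))) p,
      IsExtensionOperator E →
    ∀ (x : EuclideanSpace ℝ (Fin n)) (s t r : ℝ), 0 ≤ s → s < t → t < r →
    ∀ Ω' : Set (EuclideanSpace ℝ (Fin n)), IsConnectedComponentOf Ω' (Ω ∩ Metric.ball x r) →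
    ∃ (v : EuclideanSpace ℝ (Fin n) → ℝ) (g : EuclideanSpace ℝ (Fin n) → EuclideanSpace ℝ (Fin n)),
      IsWeakGradientOn univ v g ∧ Integrable (fun z => ‖g z‖ ^ p) ∧
      (∀ᵐ z, z ∈ Ω' ∩ Metric.ball x s → v z = 1) ∧
      (∀ᵐ z, z ∈ Ω \ (Ω' ∩ Metric.ball x t) → v z = 0) ∧
      ∫ z, ‖g z‖ ^ p ≤ (extensionNorm E * (L / (t - s))) ^ p *
        volume.real (Ω' ∩ Metric.ball x t) := by
  obtain ⟨L, hL0, hL⟩ := exists_cutoff n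
  have hp0 : 0 < p := by linarith
  refine ⟨L, hL0, fun Ω hΩ E hE x s t r hs hst htr Ω' hΩ' => ?_⟩
  obtain ⟨y, hy, rfl⟩ := hΩ'
  set A := connectedComponentIn (Ω ∩ Metric.ball x r) y with hA
  have hS : IsOpen (Ω ∩ Metric.ball x r) := hΩ.inter Metric.isOpen_ball
  have hAo : IsOpen A := hS.connectedComponentIn
  have hAS : A ⊆ Ω ∩ Metric.ball x r := connectedComponentIn_subset _ _
  have hAΩ : A ⊆ Ω := hAS.trans inter_subset_left
  obtain ⟨ψ, hψ, hψ1, hψ0, hdψ0, hdψ⟩ := hL x s t hs hst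
  -- A point of Ω outside A either lies in the ball, where the other components form an open set, or
  -- off it, where ψ vanishes nearby because t < r.
  have hw : IsWeakGradientOn Ω (A.indicator ψ) (A.indicator (gradient ψ)) := by
    refine isWeakGradientOn_indicator hAo hAΩ hψ fun z hz hzA => ?_
    by_cases hzr : z ∈ Metric.ball x r
    · filter_upwards [(isOpen_diff_connectedComponentIn hS y).mem_nhds ⟨⟨hz, hzr⟩, hzA⟩] with w hw
      exact indicator_of_notMem hw.2 _
    · have : z ∈ (Metric.closedBall x t)ᶜ := fun h => hzr (Metric.closedBall_subset_ball htr h)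
      filter_upwards [Metric.isClosed_closedBall.isOpen_compl.mem_nhds this] with w hw
      rw [indicator_apply_eq_zero]
      exact fun _ => hψ0 w fun h => hw (Metric.ball_subset_closedBall h)
  have hgn : ∀ z, ‖gradient ψ z‖ = ‖fderiv ℝ ψ z‖ := fun z => by
    rw [gradient, LinearIsometryEquiv.norm_map]
  have hgc : Continuous (gradient ψ) :=
    (InnerProductSpace.toDual ℝ _).symm.continuous.comp (hψ.continuous_fderiv (by simp))
  have hgs : HasCompactSupport (gradient ψ) :=
    HasCompactSupport.of_support_subset_isCompact (isCompact_closedBall x t) fun z hz => by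
      by_contra h
      apply hz
      rw [← norm_eq_zero, hgn, hdψ0 z fun h' => h (Metric.ball_subset_closedBall h'), norm_zero]
  have hmem : MemLp (A.indicator (gradient ψ)) (ENNReal.ofReal p) (volume.restrict Ω) :=
    ((hgc.memLp_of_hasCompactSupport hgs).indicator hAo.measurableSet).restrict Ω
  have hmeas : AEStronglyMeasurable (A.indicator ψ) (volume.restrict Ω) :=
    (hψ.continuous.aestronglyMeasurable.indicator hAo.measurableSet).restrict
  have hae : A.indicator ψ =ᵐ[volume.restrict Ω] AEEqFun.mk _ hmeas := (AEEqFun.coeFn_mk _ hmeas).symm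
  set u : HomSobolev Ω p := ⟨AEEqFun.mk _ hmeas, _, hw.congr_ae hae, hmem⟩ with hu
  have huw : IsWeakGradientOn Ω u.1 (HomSobolev.weakGrad u) := u.2.choose_spec.1
  have hgrad : HomSobolev.weakGrad u =ᵐ[volume.restrict Ω] A.indicator (gradient ψ) :=
    huw.ae_eq hΩ (hw.congr_ae hae)
  have hEspec : IsWeakGradientOn univ (E u).1 (HomSobolev.weakGrad (E u)) ∧
      MemLp (HomSobolev.weakGrad (E u)) (ENNReal.ofReal p) (volume.restrict univ) :=
    (E u).2.choose_spec
  have hp' : ENNReal.ofReal p ≠ 0 := by simpa using hp0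
  have hEv : ∀ᵐ z, z ∈ Ω → (E u).1 z = A.indicator ψ z := by
    rw [← ae_restrict_iff' hΩ.measurableSet]
    filter_upwards [hE.1 u, hae] with z h1 h2
    rw [h1, h2]
  refine ⟨(E u).1, HomSobolev.weakGrad (E u), hEspec.1, ?_, ?_, ?_, ?_⟩
  · have := hEspec.2.integrable_norm_rpow hp' ENNReal.ofReal_ne_top
    rw [ENNReal.toReal_ofReal hp0.le] at this
    exact integrableOn_univ.1 this
  · filter_upwards [hEv] with z hz hzA
    rw [hz (hAΩ hzA.1), indicator_of_mem hzA.1, hψ1 z hzA.2]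
  · filter_upwards [hEv] with z hz hzA
    rw [hz hzA.1, indicator_apply_eq_zero]
    exact fun h => hψ0 z fun h' => hzA.2 ⟨h, h'⟩
  · have hmemE := extensionNorm_mem_extensionConstants hE.2
    have hE0 : 0 ≤ extensionNorm E := by linarith [hmemE.1]
    have h1 := Real.rpow_le_rpow (HomSobolev.seminorm_nonneg _) (hmemE.2 u) hp0.le
    rw [Real.mul_rpow hE0 (HomSobolev.seminorm_nonneg _), HomSobolev.seminorm_rpow hp,
      HomSobolev.seminorm_rpow hp, setIntegral_univ] at h1
    have hts : 0 ≤ L / (t - s) := div_nonneg hL0.le (by linarith)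
    rw [Real.mul_rpow hE0 hts, mul_assoc]
    refine h1.trans (mul_le_mul_of_nonneg_left ?_ (by positivity))
    have hB : MeasurableSet (A ∩ Metric.ball x t) := hAo.measurableSet.inter measurableSet_ball
    have hBfin : volume (A ∩ Metric.ball x t) < ⊤ :=
      (measure_mono inter_subset_right).trans_lt measure_ball_lt_top
    have hind : Integrable ((A ∩ Metric.ball x t).indicator fun _ => (L / (t - s)) ^ p) volume :=
      (integrable_indicator_iff hB).2 (integrableOn_const hBfin.ne)
    calc ∫ z in Ω, ‖HomSobolev.weakGrad u z‖ ^ p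
        = ∫ z in Ω, ‖A.indicator (gradient ψ) z‖ ^ p := by
          refine integral_congr_ae ?_
          filter_upwards [hgrad] with z hz
          rw [hz]
      _ ≤ ∫ z in Ω, (A ∩ Metric.ball x t).indicator (fun _ => (L / (t - s)) ^ p) z := by
          refine integral_mono_of_nonneg (ae_of_all _ fun z => by positivity)
            hind.integrableOn (ae_of_all _ fun z => ?_)
          by_cases hz : z ∈ A ∩ Metric.ball x t
          · simp only [indicator_of_mem hz, indicator_of_mem hz.1]
            rw [hgn]
            exact Real.rpow_le_rpow (norm_nonneg _) (hdψ z) hp0.le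
          · simp only [indicator_of_notMem hz]
            have : A.indicator (gradient ψ) z = 0 := by
              rw [indicator_apply_eq_zero]
              intro hzA
              rw [← norm_eq_zero, hgn, hdψ0 z fun h => hz ⟨hzA, h⟩, norm_zero]
            rw [this, norm_zero, Real.zero_rpow hp0.ne']
      _ ≤ ∫ z, (A ∩ Metric.ball x t).indicator (fun _ => (L / (t - s)) ^ p) z :=
          setIntegral_le_integral hind (ae_of_all _ fun z =>
            indicator_nonneg (fun _ _ => by positivity) z)
      _ = _ := by
          rw [integral_indicator hB, setIntegral_const, smul_eq_mul, mul_comm]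

end Extension

/-- Otherwise the radii `S j`, with successive gaps B m(T)^α θ^j, all stay above some τ > 0. Each
gap is long enough to halve m again, because m(S j)^α ≤ m(T)^α θ^j, and this contradicts m(τ) > 0.
-/
theorem le_of_halving {m : ℝ → ℝ} (hm : Monotone m) (hpos : ∀ t, 0 < t → 0 < m t) {α B T : ℝ}
    (hα : 0 < α) (hB : 0 < B) (hT : 0 < T)
    (h : ∀ s t, 0 ≤ s → s < t → t ≤ T → B * m t ^ α ≤ t - s → m s ≤ m t / 2) :
    T ≤ B * m T ^ α / (1 - (1 / 2) ^ α) := by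
  set θ : ℝ := (1 / 2) ^ α with hθ
  have hθ0 : 0 < θ := by positivity
  have hθ1 : θ < 1 := Real.rpow_lt_one (by norm_num) (by norm_num) hα
  have hmT := hpos T hT
  by_contra! hcon
  set τ := T - B * m T ^ α / (1 - θ) with hτ
  have hτ0 : 0 < τ := by linarith
  set S : ℕ → ℝ := fun j => T - B * m T ^ α * ∑ i ∈ Finset.range j, θ ^ i with hS
  have hτS : ∀ j, τ ≤ S j := fun j => by
    have : ∑ i ∈ Finset.range j, θ ^ i ≤ (1 - θ)⁻¹ := by
      rw [← tsum_geometric_of_lt_one hθ0.le hθ1]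
      exact (summable_geometric_of_lt_one hθ0.le hθ1).sum_le_tsum _ fun i _ => by positivity
    have h2 : B * m T ^ α * ∑ i ∈ Finset.range j, θ ^ i ≤ B * m T ^ α / (1 - θ) := by
      rw [div_eq_mul_inv]; gcongr
    simp only [hS, hτ]
    linarith
  have hST : ∀ j, S j ≤ T := fun j => by
    have : 0 ≤ B * m T ^ α * ∑ i ∈ Finset.range j, θ ^ i := by positivity
    simp only [hS]; linarith
  have hmS : ∀ j, m (S j) ≤ m T * (1 / 2) ^ j := by
    intro j
    induction j with
    | zero => simp [hS]
    | succ j ih =>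
      have hstep : S j - S (j + 1) = B * (m T ^ α * θ ^ j) := by
        simp only [hS, Finset.sum_range_succ]; ring
      have hle : m (S j) ^ α ≤ m T ^ α * θ ^ j := by
        refine (Real.rpow_le_rpow (hpos _ (hτ0.trans_le (hτS j))).le ih hα.le).trans_eq ?_
        rw [Real.mul_rpow hmT.le (by positivity), hθ, ← Real.rpow_natCast, ← Real.rpow_natCast,
          ← Real.rpow_mul (by norm_num), ← Real.rpow_mul (by norm_num), mul_comm α]
      have h1 : 0 < B * (m T ^ α * θ ^ j) := by positivity
      have h2 := h (S (j + 1)) (S j) (hτ0.le.trans (hτS _)) (by linarith) (hST j)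
        (by rw [hstep]; gcongr)
      rw [pow_succ]
      linarith
  obtain ⟨j, hj⟩ := exists_pow_lt_of_lt_one (div_pos (hpos τ hτ0) hmT)
    (by norm_num : (1 / 2 : ℝ) < 1)
  rw [lt_div_iff₀ hmT] at hj
  have := (hm (hτS j)).trans (hmS j)
  linarith

/-! ### Volume and geometry of components -/

section Geometry

variable {n : ℕ}

theorem volume_real_inter_ball_pos {A : Set (EuclideanSpace ℝ (Fin n))} (hA : IsOpen A)
    {x : EuclideanSpace ℝ (Fin n)} (hx : x ∈ closure A) {t : ℝ} (ht : 0 < t) :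
    0 < volume.real (A ∩ Metric.ball x t) := by
  have hne : (A ∩ Metric.ball x t).Nonempty := by
    obtain ⟨z, hz, hd⟩ := Metric.mem_closure_iff.1 hx t ht
    exact ⟨z, hz, by rwa [Metric.mem_ball, dist_comm]⟩
  exact ENNReal.toReal_pos ((hA.inter Metric.isOpen_ball).measure_pos volume hne).ne'
    ((measure_mono inter_subset_right).trans_lt measure_ball_lt_top).ne

theorem monotone_volume_real_inter_ball (A : Set (EuclideanSpace ℝ (Fin n)))
    (x : EuclideanSpace ℝ (Fin n)) :
    Monotone fun t => volume.real (A ∩ Metric.ball x t) := fun _ _ hst =>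
  measureReal_mono (inter_subset_inter_right _ (Metric.ball_subset_ball hst))
    ((measure_mono inter_subset_right).trans_lt measure_ball_lt_top).ne

theorem volume_closedBall_lt_volume_diff {Ω : Set (EuclideanSpace ℝ (Fin n))} (hn : n ≠ 0)
    (x : EuclideanSpace ℝ (Fin n)) {r : ℝ} (hr : 0 < r)
    (hrΩ : ENNReal.ofReal r <
      (volume Ω / (2 * volume (Metric.ball (0 : EuclideanSpace ℝ (Fin n)) 1))) ^ (1 / (n : ℝ))) :
    volume (Metric.closedBall x r) < volume (Ω \ Metric.closedBall x r) := by
  have hn0 : (0 : ℝ) < n := by positivity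
  have h1 := ENNReal.rpow_lt_rpow hrΩ hn0
  rw [← ENNReal.rpow_mul, one_div, inv_mul_cancel₀ hn0.ne', ENNReal.rpow_one, ENNReal.rpow_natCast,
    ENNReal.lt_div_iff_mul_lt (Or.inr (by simp))
      (Or.inr (pow_ne_zero n (ENNReal.ofReal_pos.2 hr).ne'))] at h1
  have hβ : volume (Metric.closedBall x r) = ENNReal.ofReal r ^ n *
      volume (Metric.ball (0 : EuclideanSpace ℝ (Fin n)) 1) := by
    rw [Measure.addHaar_closedBall _ _ hr.le, finrank_euclideanSpace_fin, ENNReal.ofReal_pow hr.le]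
  have h2 : volume (Metric.closedBall x r) + volume (Metric.closedBall x r) <
      volume (Ω \ Metric.closedBall x r) + volume (Metric.closedBall x r) := by
    calc _ = ENNReal.ofReal r ^ n *
          (2 * volume (Metric.ball (0 : EuclideanSpace ℝ (Fin n)) 1)) := by rw [hβ]; ring
      _ < volume Ω := h1
      _ ≤ volume (Ω \ Metric.closedBall x r ∪ Metric.closedBall x r) :=
          measure_mono (by rw [sdiff_union_self]; exact subset_union_left)
      _ ≤ _ := measure_union_le _ _
  exact lt_of_add_lt_add_right h2

/-- A component of `Ω ∩ B(x, r)` leaves `B(x, r / 2)` when `r < diam Ω`. -/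
theorem exists_half_le_dist {Ω : Set (EuclideanSpace ℝ (Fin n))} (hΩ : IsOpen Ω)
    (hc : IsConnected Ω) {x : EuclideanSpace ℝ (Fin n)} {r : ℝ} (hr : 0 < r)
    (hrΩ : ENNReal.ofReal r < Metric.ediam Ω) {Ω' : Set (EuclideanSpace ℝ (Fin n))}
    (hΩ' : IsConnectedComponentOf Ω' (Ω ∩ Metric.ball x r)) : ∃ z ∈ Ω', r / 2 ≤ dist z x := by
  obtain ⟨y, hy, rfl⟩ := hΩ'
  by_contra! hcon
  have hS : IsOpen (Ω ∩ Metric.ball x r) := hΩ.inter Metric.isOpen_ball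
  set A := connectedComponentIn (Ω ∩ Metric.ball x r) y with hA
  -- A component inside B(x,r/2) would be separated from the rest of Ω by open sets, hence would be
  -- all of Ω, and Ω would have diameter at most r.
  have hsub : Ω ⊆ A := by
    refine hc.isPreconnected.subset_left_of_subset_union (v := (Ω ∩ Metric.ball x r) \ A ∪
      (Metric.closedBall x (r / 2))ᶜ) hS.connectedComponentIn
      ((isOpen_diff_connectedComponentIn hS y).union Metric.isClosed_closedBall.isOpen_compl)
      ?_ ?_ ⟨y, hy.1, mem_connectedComponentIn hy⟩
    · rw [disjoint_union_right]
      refine ⟨disjoint_sdiff_right, ?_⟩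
      rw [disjoint_compl_right_iff_subset]
      exact fun z hz => (hcon z hz).le
    · intro z hz
      by_cases hzA : z ∈ A
      · exact Or.inl hzA
      · by_cases hzr : z ∈ Metric.ball x r
        · exact Or.inr (Or.inl ⟨⟨hz, hzr⟩, hzA⟩)
        · refine Or.inr (Or.inr fun h => hzr ?_)
          exact Metric.closedBall_subset_ball (by linarith) h
  refine absurd hrΩ (not_lt.2 (Metric.ediam_le fun a ha b hb => ?_))
  rw [edist_dist]
  refine ENNReal.ofReal_le_ofReal ?_
  have h1 := hcon a (hsub ha)
  have h2 := hcon b (hsub hb)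
  have h3 := dist_triangle_right a b x
  linarith

/-- The distances from x to a connected set form an interval, and they come arbitrarily close to 0.
-/
theorem Ioo_subset_image_dist {A : Set (EuclideanSpace ℝ (Fin n))} (hA : IsPreconnected A)
    {x : EuclideanSpace ℝ (Fin n)} (hx : x ∈ closure A) {R : ℝ} (hR : ∃ z ∈ A, R ≤ dist z x) :
    Ioo 0 R ⊆ (fun z => dist z x) '' A := by
  intro t ht
  obtain ⟨z, hz, hzR⟩ := hR
  obtain ⟨w, hw, hwt⟩ := Metric.mem_closure_iff.1 hx t ht.1
  have := (hA.image (fun z => dist z x) (by fun_prop)).ordConnected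
  rw [dist_comm] at hwt
  exact this.out (mem_image_of_mem _ hw) (mem_image_of_mem _ hz) ⟨hwt.le, ht.2.le.trans hzR⟩

end Geometry

/-! ### The two density estimates -/

theorem measure_density_of_lt {n : ℕ} {p : ℝ} (hp : 1 ≤ p) (hpn : p < n) : ∃ C : ℝ, 0 < C ∧
      ∀ Ω : Set (EuclideanSpace ℝ (Fin n)), IsOpen Ω → IsConnected Ω →
      ∀ E : HomSobolev Ω p → HomSobolev (univ : Set (EuclideanSpace ℝ (Fin n))) p,
        IsExtensionOperator E →
      ∀ x ∈ closure Ω, ∀ r : ℝ, 0 < r →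
        ENNReal.ofReal r <
          min 1 ((volume Ω / (2 * volume (Metric.ball (0 : EuclideanSpace ℝ (Fin n)) 1))) ^
            (1 / (n : ℝ))) →
      ∀ Ω' : Set (EuclideanSpace ℝ (Fin n)), IsConnectedComponentOf Ω' (Ω ∩ Metric.ball x r) →
        x ∈ closure Ω' →
        ENNReal.ofReal (C * extensionNorm E ^ (-(n : ℝ)) * r ^ n) ≤ volume Ω' := by
  have hp0 : 0 < p := by linarith
  have hn0 : (0 : ℝ) < n := by linarith
  have hn : n ≠ 0 := by rintro rfl; simp at hn0
  obtain ⟨η, C, hη, hC, hcap⟩ := exists_volume_le_of_integral_le hp hpn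
  obtain ⟨L, hL, hext⟩ := exists_extension_cutoff n hp
  set θ : ℝ := (1 / 2) ^ (1 / (n : ℝ)) with hθ
  have hθ1 : θ < 1 := Real.rpow_lt_one (by norm_num) (by norm_num) (by positivity)
  have hθ' : 0 < 1 - θ := by linarith
  -- Chosen so that t - s ≥ K b ρ brings the energy of the extension below η ρ^(n-p), where ρ^n =
  -- m(t)/(2C).
  set b : ℝ := L / (η / (2 * C)) ^ (1 / p) with hb
  have hb0 : 0 < b := by positivity
  refine ⟨2 * C * ((1 - θ) / (2 * b)) ^ n, by positivity,
    fun Ω hΩ _ E hE x _ r hr hrΩ Ω' hΩ' hx => ?_⟩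
  have hAvol := volume_closedBall_lt_volume_diff hn x hr (hrΩ.trans_le (min_le_right _ _))
  have hΩ'o : IsOpen Ω' := by
    obtain ⟨y, _, rfl⟩ := hΩ'
    exact (hΩ.inter Metric.isOpen_ball).connectedComponentIn
  set K := extensionNorm E with hK
  have hK0 : 0 < K := by linarith [hE.one_le_extensionNorm]
  set m : ℝ → ℝ := fun t => volume.real (Ω' ∩ Metric.ball x t) with hm
  have hmpos : ∀ t, 0 < t → 0 < m t := fun t ht => volume_real_inter_ball_pos hΩ'o hx ht
  -- T = r/2 guarantees t < r, as the cutoff requires.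
  have key := le_of_halving (m := m) (monotone_volume_real_inter_ball Ω' x) hmpos
    (α := 1 / (n : ℝ)) (B := K * b / (2 * C) ^ (1 / (n : ℝ))) (T := r / 2) (by positivity)
    (by positivity) (half_pos hr) (fun s t hs hst htr hle => by
      have ht0 : 0 < t := hs.trans_lt hst
      obtain ⟨v, g, hvg, hgi, hv1, hv0, hG⟩ := hext Ω hΩ E hE x s t r hs hst (by linarith) Ω' hΩ'
      -- With this ρ, C ρ^n = m(t)/2. The alternative for `D` is then the halving, and the one for
      -- `A` would give Ω minus the closed ball less volume than that ball.
      set ρ : ℝ := m t ^ (1 / (n : ℝ)) / (2 * C) ^ (1 / (n : ℝ)) with hρ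
      have hmt := hmpos t ht0
      have hρ0 : 0 < ρ := by positivity
      have hρn : ρ ^ n = m t / (2 * C) := by
        rw [hρ, ← Real.div_rpow hmt.le (by positivity), ← Real.rpow_natCast,
          ← Real.rpow_mul (by positivity), one_div, inv_mul_cancel₀ hn0.ne', Real.rpow_one]
      have hle' : K * b * ρ ≤ t - s := by
        refine le_of_eq_of_le ?_ hle
        rw [hρ]; ring
      have hts : 0 < t - s := by linarith
      have hratio : K * (L / (t - s)) ≤ (η / (2 * C)) ^ (1 / p) / ρ := by
        rw [← mul_div_assoc, div_le_div_iff₀ hts hρ0]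
        have e : (η / (2 * C)) ^ (1 / p) * b = L := by rw [hb]; field_simp
        calc K * L * ρ = (η / (2 * C)) ^ (1 / p) * (K * b * ρ) := by rw [← e]; ring
          _ ≤ _ := by gcongr
      have hen : ∫ z, ‖g z‖ ^ p ≤ η * (ρ ^ n / ρ ^ p) := by
        refine hG.trans ?_
        calc (K * (L / (t - s))) ^ p * m t ≤ ((η / (2 * C)) ^ (1 / p) / ρ) ^ p * m t := by
              gcongr
          _ = η * (ρ ^ n / ρ ^ p) := by
              rw [Real.div_rpow (by positivity) hρ0.le, ← Real.rpow_mul (by positivity), one_div,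
                inv_mul_cancel₀ hp0.ne', Real.rpow_one, hρn]
              field_simp
      have hCρ : C * ρ ^ n = m t / 2 := by rw [hρn]; field_simp
      have hmball : m t ≤ volume.real (Metric.closedBall x r) :=
        measureReal_mono (inter_subset_right.trans ((Metric.ball_subset_ball
          (by linarith)).trans Metric.ball_subset_closedBall)) measure_closedBall_lt_top.ne
      rcases hcap v g hvg hgi ρ hρ0 hen (Ω \ Metric.closedBall x r) (Ω' ∩ Metric.ball x s)
        (hΩ.sdiff Metric.isClosed_closedBall) (hΩ'o.inter Metric.isOpen_ball) (by
          filter_upwards [hv0] with z hz hzA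
          refine hz ⟨hzA.1, fun h => hzA.2 ?_⟩
          exact Metric.ball_subset_closedBall (Metric.ball_subset_ball (by linarith) h.2)) hv1
        with h | h
      · exfalso
        have h1 : volume.real (Metric.closedBall x r) < C * ρ ^ n :=
          ENNReal.toReal_lt_of_lt_ofReal (hAvol.trans_le h)
        linarith
      · have h1 := ENNReal.toReal_le_of_le_ofReal (by positivity) h
        rwa [hCρ] at h1)
  rw [← hθ] at key
  have hmr := hmpos (r / 2) (half_pos hr)
  have h1 : (1 - θ) / (2 * b) * K⁻¹ * r ≤ (m (r / 2) / (2 * C)) ^ (1 / (n : ℝ)) := by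
    rw [Real.div_rpow hmr.le (by positivity)]
    rw [le_div_iff₀ hθ'] at key
    calc (1 - θ) / (2 * b) * K⁻¹ * r = r / 2 * (1 - θ) / (K * b) := by field_simp
      _ ≤ K * b / (2 * C) ^ (1 / (n : ℝ)) * m (r / 2) ^ (1 / (n : ℝ)) / (K * b) := by gcongr
      _ = _ := by field_simp
  have h2 := pow_le_pow_left₀ (by positivity) h1 n
  rw [← Real.rpow_natCast ((m (r / 2) / (2 * C)) ^ (1 / (n : ℝ))),
    ← Real.rpow_mul (by positivity), one_div, inv_mul_cancel₀ hn0.ne', Real.rpow_one,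
    le_div_iff₀ (by positivity)] at h2
  refine (ENNReal.ofReal_le_of_le_toReal (b := volume (Ω' ∩ Metric.ball x (r / 2))) ?_).trans
    (measure_mono inter_subset_left)
  refine le_of_eq_of_le ?_ h2
  rw [Real.rpow_neg hK0.le, Real.rpow_natCast, mul_pow, mul_pow, inv_pow]
  ring

theorem measure_density_of_sub_one_lt {n : ℕ} {p : ℝ} (hp : 1 ≤ p) (hpn : (n : ℝ) - 1 < p) :
    ∃ C : ℝ, 0 < C ∧
      ∀ Ω : Set (EuclideanSpace ℝ (Fin n)), IsOpen Ω → IsConnected Ω →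
      ∀ E : HomSobolev Ω p → HomSobolev (univ : Set (EuclideanSpace ℝ (Fin n))) p,
        IsExtensionOperator E →
      ∀ x ∈ closure Ω, ∀ r : ℝ, 0 < r → ENNReal.ofReal r < Metric.ediam Ω →
      ∀ Ω' : Set (EuclideanSpace ℝ (Fin n)), IsConnectedComponentOf Ω' (Ω ∩ Metric.ball x r) →
        x ∈ closure Ω' →
        ENNReal.ofReal (C * extensionNorm E ^ (-p) * r ^ n) ≤ volume Ω' := by
  have hp0 : 0 < p := by linarith
  obtain ⟨c, hc, hcap⟩ := exists_mul_pow_le_integral hp hpn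
  obtain ⟨L, hL, hext⟩ := exists_extension_cutoff n hp
  refine ⟨c / (8 * L) ^ p, by positivity, fun Ω hΩ hΩc E hE x _ r hr hrΩ Ω' hΩ' hx => ?_⟩
  have hfar := exists_half_le_dist hΩ hΩc hr hrΩ hΩ'
  -- The radii r/8 and r/4 leave the radial intervals (0, r/8), where v = 1, and (r/4, r/2), where v
  -- = 0; both have length at least r/8.
  obtain ⟨v, g, hvg, hgi, hv1, hv0, hG⟩ := hext Ω hΩ E hE x (r / 8) (r / 4) r (by positivity)
    (by linarith) (by linarith) Ω' hΩ'
  obtain ⟨y, hy, rfl⟩ := hΩ'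
  set A := connectedComponentIn (Ω ∩ Metric.ball x r) y with hA
  have hAo : IsOpen A := (hΩ.inter Metric.isOpen_ball).connectedComponentIn
  have hAΩ : A ⊆ Ω := (connectedComponentIn_subset _ _).trans inter_subset_left
  have himg := Ioo_subset_image_dist isPreconnected_connectedComponentIn hx hfar
  set K := extensionNorm E with hK
  have hK0 : 0 < K := by linarith [hE.one_le_extensionNorm]
  have key := hcap v g hvg hgi x r hr (A ∩ (Metric.ball x (r / 2) \ Metric.closedBall x (r / 4)))
    (A ∩ Metric.ball x (r / 8))
    (hAo.inter (Metric.isOpen_ball.sdiff Metric.isClosed_closedBall))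
    (hAo.inter Metric.isOpen_ball) (inter_subset_right.trans sdiff_subset)
    (inter_subset_right.trans (Metric.ball_subset_ball (by linarith))) (by
      have : Ioo (r / 4) (r / 2) ⊆ (fun z => dist z x) ''
          (A ∩ (Metric.ball x (r / 2) \ Metric.closedBall x (r / 4))) := by
        intro t ht
        obtain ⟨z, hz, rfl⟩ := himg ⟨(by positivity : 0 < r / 4).trans ht.1, ht.2⟩
        exact ⟨z, ⟨hz, ht.2, fun h => not_lt.2 h ht.1⟩, rfl⟩
      refine le_trans ?_ (measure_mono this)
      rw [Real.volume_Ioo]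
      exact ENNReal.ofReal_le_ofReal (by linarith)) (by
      have : Ioo 0 (r / 8) ⊆ (fun z => dist z x) '' (A ∩ Metric.ball x (r / 8)) := by
        intro t ht
        obtain ⟨z, hz, rfl⟩ := himg ⟨ht.1, ht.2.trans (by linarith)⟩
        exact ⟨z, ⟨hz, ht.2⟩, rfl⟩
      refine le_trans ?_ (measure_mono this)
      rw [Real.volume_Ioo, sub_zero]) (by
      filter_upwards [hv0] with z hz hzA
      exact hz ⟨hAΩ hzA.1, fun h => hzA.2.2 (Metric.ball_subset_closedBall h.2)⟩) hv1
  refine (ENNReal.ofReal_le_of_le_toReal (b := volume (A ∩ Metric.ball x (r / 4))) ?_).trans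
    (measure_mono inter_subset_left)
  have h1 := key.trans (mul_le_mul_of_nonneg_left hG (by positivity))
  have h2 : r ^ p * (K * (L / (r / 4 - r / 8))) ^ p = (8 * L) ^ p * K ^ p := by
    rw [← Real.mul_rpow hr.le (mul_nonneg hK0.le (div_nonneg hL.le (by linarith))),
      ← Real.mul_rpow (by positivity) hK0.le]
    congr 1
    have : r / 4 - r / 8 = r / 8 := by ring
    rw [this]
    field_simp
  rw [← mul_assoc, h2] at h1
  rw [Real.rpow_neg hK0.le]
  calc c / (8 * L) ^ p * (K ^ p)⁻¹ * r ^ n = c * r ^ n / ((8 * L) ^ p * K ^ p) := by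
        field_simp
    _ ≤ volume.real (A ∩ Metric.ball x (r / 4)) := by
        rw [div_le_iff₀ (by positivity), mul_comm (volume.real _)]
        exact h1

theorem proposition2p2 (n : ℕ) (p : ℝ) (hp : 1 ≤ p) :
    (p < n → ∃ C : ℝ, 0 < C ∧
      ∀ Ω : Set (EuclideanSpace ℝ (Fin n)), IsOpen Ω → IsConnected Ω →
      ∀ E : HomSobolev Ω p → HomSobolev (univ : Set (EuclideanSpace ℝ (Fin n))) p,
        IsExtensionOperator E →
      ∀ x ∈ closure Ω, ∀ r : ℝ, 0 < r →
        ENNReal.ofReal r <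
          min 1 ((volume Ω / (2 * volume (Metric.ball (0 : EuclideanSpace ℝ (Fin n)) 1))) ^
            (1 / (n : ℝ))) →
      ∀ Ω' : Set (EuclideanSpace ℝ (Fin n)), IsConnectedComponentOf Ω' (Ω ∩ Metric.ball x r) →
        x ∈ closure Ω' →
        ENNReal.ofReal (C * extensionNorm E ^ (-(n : ℝ)) * r ^ n) ≤ volume Ω') ∧
    ((n : ℝ) - 1 < p → ∃ C : ℝ, 0 < C ∧
      ∀ Ω : Set (EuclideanSpace ℝ (Fin n)), IsOpen Ω → IsConnected Ω →
      ∀ E : HomSobolev Ω p → HomSobolev (univ : Set (EuclideanSpace ℝ (Fin n))) p,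
        IsExtensionOperator E →
      ∀ x ∈ closure Ω, ∀ r : ℝ, 0 < r → ENNReal.ofReal r < Metric.ediam Ω →
      ∀ Ω' : Set (EuclideanSpace ℝ (Fin n)), IsConnectedComponentOf Ω' (Ω ∩ Metric.ball x r) →
        x ∈ closure Ω' →
        ENNReal.ofReal (C * extensionNorm E ^ (-p) * r ^ n) ≤ volume Ω') :=
  ⟨measure_density_of_lt hp, measure_density_of_sub_one_lt hp⟩
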